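/- Let $\mathbb{D}$ be the open unit disc in $\mathbb{C}$ and let $A^2(\mathbb{D}^2)$ be the Bergman space of the bidisc, that is, the space of holomorphic functions $f:\mathbb{D}^2\to\mathbb{C}$ with $\int_{\mathbb{D}^2}|f|^2\,dV<\infty$, with the norm of $L^2(\mathbb{D}^2)$, where $V$ is Lebesgue measure. For $a\in\mathbb{D}^2$ let $K_a\in A^2(\mathbb{D}^2)$ be the Bergman kernel, determined by $f(a)=\langle f,K_a\rangle$ for all $f\in A^2(\mathbb{D}^2)$. Let $\varphi=(\varphi_1,\varphi_2):\mathbb{D}^2\to\mathbb{D}^2$ be a holomorphic map such that both $\varphi_1$ and $\varphi_2$ are Lipschitz on $\overline{\mathbb{D}^2}$ (that is, extend to Lipschitz functions on $\overline{\mathbb{D}^2}$). Then the composition operator $C_\varphi f=f\circ\varphi$ is compact on $A^2(\mathbb{D}^2)$ (that is, it maps $A^2(\mathbb{D}^2)$ into itself and is a compact operator there) if and only if $$\lim_{\mathbb{D}^2\ni z\to b\mathbb{D}^2}\frac{K_{\varphi(z)}(\varphi(z))}{K_z(z)}=0,$$ where $b\mathbb{D}^2$ is the topological boundary of $\mathbb{D}^2$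 and $z\to b\mathbb{D}^2$ means that the distance from $z$ to $b\mathbb{D}^2$ tends to $0$. -/

import Mathlib

open MeasureTheory Filter Topology Set

/-- The open unit bidisc in `ℂ²`. -/
def bidisc : Set (ℂ × ℂ) := Metric.ball (0 : ℂ) 1 ×ˢ Metric.ball (0 : ℂ) 1

/-- `f` is holomorphic on `Ω` and square integrable on `Ω` for Lebesgue measure. -/
def MemBergman (Ω : Set (ℂ × ℂ)) (f : ℂ × ℂ → ℂ) : Prop :=
  DifferentiableOn ℂ f Ω ∧ MemLp f 2 (volume.restrict Ω)

/-- The Bergman space `A²(Ω)`, as a subspace of `L²(Ω)` with the norm of `L²(Ω)`: the classes that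
contain a function holomorphic on `Ω`. For open `Ω` the values of that function on `Ω` are
determined by the class. -/
def bergmanSpace (Ω : Set (ℂ × ℂ)) : Submodule ℂ (Lp ℂ 2 (volume.restrict Ω)) where
  carrier := {F | ∃ f : ℂ × ℂ → ℂ, DifferentiableOn ℂ f Ω ∧ F =ᵐ[volume.restrict Ω] f}
  zero_mem' := ⟨0, differentiableOn_const 0, Lp.coeFn_zero _ _ _⟩
  add_mem' := by
    rintro F G ⟨f, hf, hFf⟩ ⟨g, hg, hGg⟩
    exact ⟨f + g, hf.add hg, (Lp.coeFn_add F G).trans (hFf.add hGg)⟩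
  smul_mem' := by
    rintro c F ⟨f, hf, hFf⟩
    exact ⟨c • f, hf.const_smul c, (Lp.coeFn_smul c F).trans (hFf.const_smul c)⟩

/-- `k` represents evaluation at `a` on `A²(Ω)`: it lies in `A²(Ω)` and `f(a) = ⟨f, k⟩` for all
`f` in `A²(Ω)`. -/
def IsBergmanKernelAt (Ω : Set (ℂ × ℂ)) (a : ℂ × ℂ) (k : ℂ × ℂ → ℂ) : Prop :=
  MemBergman Ω k ∧
    ∀ f : ℂ × ℂ → ℂ, MemBergman Ω f → f a = ∫ z in Ω, f z * (starRingEnd ℂ) (k z)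

open Classical in
/-- The Bergman kernel `K_a(z)` of `Ω`. For open `Ω` and `a ∈ Ω` the representing function exists
(point evaluations are bounded, so that the Riesz representation theorem applies) and its values
on `Ω` are unique; the value `0` is used only for other `Ω` or `a`. -/
noncomputable def bergmanKernel (Ω : Set (ℂ × ℂ)) (a : ℂ × ℂ) : ℂ × ℂ → ℂ :=
  if h : ∃ k : ℂ × ℂ → ℂ, IsBergmanKernelAt Ω a k then h.choose else 0

/-- `T` is the composition operator `C_φ : f ↦ f ∘ φ` on `A²(Ω)`. -/
def IsCompositionOperator (Ω : Set (ℂ × ℂ)) (φ : ℂ × ℂ → ℂ × ℂ)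
    (T : bergmanSpace Ω →ₗ[ℂ] bergmanSpace Ω) : Prop :=
  ∀ (F : bergmanSpace Ω) (f : ℂ × ℂ → ℂ), DifferentiableOn ℂ f Ω →
    (F : Lp ℂ 2 (volume.restrict Ω)) =ᵐ[volume.restrict Ω] f →
      (T F : Lp ℂ 2 (volume.restrict Ω)) =ᵐ[volume.restrict Ω] f ∘ φ

/-- `C_φ` maps `A²(Ω)` to itself and is a compact operator there. -/
def CompositionOperatorIsCompact (Ω : Set (ℂ × ℂ)) (φ : ℂ × ℂ → ℂ × ℂ) : Prop :=
  ∃ T : bergmanSpace Ω →ₗ[ℂ] bergmanSpace Ω, IsCompositionOperator Ω φ T ∧ IsCompactOperator T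

/-- The filter `Ω ∋ z → bΩ`: the distance from `z ∈ Ω` to the boundary of `Ω` tends to `0`. -/
noncomputable def towardBoundary (Ω : Set (ℂ × ℂ)) : Filter (ℂ × ℂ) :=
  comap (fun z => Metric.infDist z (frontier Ω)) (𝓝 0) ⊓ 𝓟 Ω

/-!
Composition operators with Lipschitz symbol on the Bergman space of the bidisc.

The disc has the reproducing kernel `(π (1 - a z̄)²)⁻¹` (`diskKernel_reproducing`), and the bidisc
the product of two such kernels (`bergmanKernel_bidisc`). Hence `K_z(z) = (π w(z))⁻²` for the weight
`w(z) = (1 - |z₁|²)(1 - |z₂|²)`, and the condition of the theorem says that `w(z) / w(φ(z))` tends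
to zero at the boundary (`tendsto_bergmanKernel_ratio_iff`).

*Necessity.* The normalised kernels tend weakly to zero at the boundary, and so uniformly on the
relatively compact image of the unit ball under `C_φ`. Pairing `K_z / ‖K_z‖` with the image of
`K_{φ(z)} / ‖K_{φ(z)}‖` gives `‖K_{φ(z)}‖ / ‖K_z‖ = w(z) / w(φ(z))`
(`tendsto_weight_ratio_of_isCompact`).

*Sufficiency.* If a coordinate of `φ` has modulus one at a boundary point `p`, the Lipschitz
condition gives `1 - |φ_j(r p)|² = O(1 - r)`. Along this radius `w(r p)` is of order `1 - r` if `p`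
is not on the distinguished boundary, and at least `(1 - r)²` in general. As the ratio tends to zero, `φ` maps
the closed bidisc without the distinguished boundary into the open bidisc
(`norm_lt_one_of_mem_closure`), and nowhere do both coordinates of `φ` have modulus one
(`min_norm_lt_one_of_mem_closure`). By compactness there is `r < 1` such that at each point one of
the coordinates of `φ` is at most `r` in modulus. In that coordinate `f` is bounded by its mean
square; in the other one Littlewood subordination applies to the slices `φ_j(·, z₂)`, uniformly in
`z₂` since `φ_j(0, z₂)` stays in a compact subset of the disc. This bounds the integral of
`|f ∘ φ|²` over `{z₂ ∈ S}` by a constant times `vol(S) ‖f‖²` (`exists_lintegral_comp_le`). The part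
`R < |z₂| < 1` is thus small in operator norm, while `φ` has its values in a compact polydisc where
`|z₂| ≤ R`, and there `f` is controlled up to a small error by finitely many functionals. Compactness
follows by total boundedness (`isCompactOperator_of_norm_le_add`).

Littlewood subordination itself (`lintegral_norm_sq_comp_le`) is proved on circles by composing the
Poisson majorant of `|g|²` with the subordinating map, and then integrated in polar coordinates.
-/

/-! ### Integration over the unit disc in polar coordinates -/

open Real in
theorem Complex.polarCoord_symm_eq_circleMap (p : ℝ × ℝ) :
    Complex.polarCoord.symm p = circleMap 0 p.1 p.2 := by
  rw [Complex.polarCoord_symm_apply, circleMap_zero, Complex.exp_mul_I]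
  simp

open Real in
theorem indicator_ball_circleMap {E : Type*} [Zero E] (G : ℂ → E) {p : ℝ × ℝ}
    (hp : p ∈ Ioi (0 : ℝ) ×ˢ Ioo (-π) π) :
    (Metric.ball (0 : ℂ) 1).indicator G (circleMap 0 p.1 p.2) =
      (Ioo (0 : ℝ) 1 ×ˢ Ioo (-π) π).indicator (fun p => G (circleMap 0 p.1 p.2)) p := by
  have h1 : circleMap 0 p.1 p.2 ∈ Metric.ball (0 : ℂ) 1 ↔ p ∈ Ioo (0 : ℝ) 1 ×ˢ Ioo (-π) π := by
    have h0 : 0 < p.1 := hp.1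
    simp only [mem_ball_zero_iff, norm_circleMap_zero, abs_of_pos h0, mem_prod, mem_Ioo, h0,
      true_and]
    exact ⟨fun h => ⟨h, hp.2⟩, fun h => h.1⟩
  by_cases h : circleMap 0 p.1 p.2 ∈ Metric.ball (0 : ℂ) 1
  · rw [indicator_of_mem h, indicator_of_mem (h1.1 h)]
  · rw [indicator_of_notMem h, indicator_of_notMem (h1.not.1 h)]

open Real in
theorem setLIntegral_ball_eq_polar (G : ℂ → ENNReal) :
    ∫⁻ z in Metric.ball 0 1, G z = ∫⁻ p in Ioo (0 : ℝ) 1 ×ˢ Ioo (-π) π,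
      ENNReal.ofReal p.1 * G (circleMap 0 p.1 p.2) := by
  have hT : MeasurableSet (Ioo (0 : ℝ) 1 ×ˢ Ioo (-π) π) := measurableSet_Ioo.prod measurableSet_Ioo
  have hsub : Ioo (0 : ℝ) 1 ×ˢ Ioo (-π) π ⊆ Ioi (0 : ℝ) ×ˢ Ioo (-π) π :=
    prod_mono Ioo_subset_Ioi_self subset_rfl
  rw [← lintegral_indicator Metric.isOpen_ball.measurableSet,
    ← Complex.lintegral_comp_polarCoord_symm, polarCoord_target,
    ← inter_eq_left.2 hsub, ← setLIntegral_indicator hT]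
  refine setLIntegral_congr_fun (measurableSet_Ioi.prod measurableSet_Ioo) fun p hp => ?_
  rw [Complex.polarCoord_symm_eq_circleMap, indicator_ball_circleMap G hp]
  simp only [indicator]
  split_ifs <;> simp

open Real in
theorem setIntegral_ball_eq_polar (G : ℂ → ℂ) :
    ∫ z in Metric.ball 0 1, G z = ∫ p in Ioo (0 : ℝ) 1 ×ˢ Ioo (-π) π,
      p.1 • G (circleMap 0 p.1 p.2) := by
  have hT : MeasurableSet (Ioo (0 : ℝ) 1 ×ˢ Ioo (-π) π) := measurableSet_Ioo.prod measurableSet_Ioo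
  have hsub : Ioo (0 : ℝ) 1 ×ˢ Ioo (-π) π ⊆ Ioi (0 : ℝ) ×ˢ Ioo (-π) π :=
    prod_mono Ioo_subset_Ioi_self subset_rfl
  rw [← integral_indicator Metric.isOpen_ball.measurableSet,
    ← Complex.integral_comp_polarCoord_symm, polarCoord_target,
    ← inter_eq_right.2 hsub, ← setIntegral_indicator hT]
  refine setIntegral_congr_fun (measurableSet_Ioi.prod measurableSet_Ioo) fun p hp => ?_
  rw [Complex.polarCoord_symm_eq_circleMap, indicator_ball_circleMap G hp]
  simp only [indicator]
  split_ifs <;> simp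

open Real in
/-- The factor `2π` and the change from `(-π, π)` to `[0, 2π]` come from the normalisation of
`circleAverage`. -/
theorem integral_Ioo_circleMap {E : Type*} [NormedAddCommGroup E] [NormedSpace ℝ E]
    (F : ℂ → E) (r : ℝ) :
    ∫ θ in Ioo (-π) π, F (circleMap 0 r θ) = (2 * π) • circleAverage F 0 r := by
  rw [circleAverage, smul_smul, mul_inv_cancel₀ two_pi_pos.ne', one_smul,
    ← integral_Ioc_eq_integral_Ioo, ← intervalIntegral.integral_of_le (by linarith [pi_pos])]
  have := ((periodic_circleMap (0 : ℂ) r).comp F).intervalIntegral_add_eq (-π) 0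
  simpa [show -π + 2 * π = π by ring] using this

theorem circleMap_mem_unitBall {r : ℝ} (hr : r ∈ Ioo (0 : ℝ) 1) (θ : ℝ) :
    circleMap 0 r θ ∈ Metric.ball (0 : ℂ) 1 := by
  simpa [abs_of_pos hr.1] using hr.2

open Real in
theorem continuousOn_comp_circleMap_prod {E : Type*} [TopologicalSpace E] {F : ℂ → E}
    (hF : ContinuousOn F (Metric.ball 0 1)) :
    ContinuousOn (fun p : ℝ × ℝ => F (circleMap 0 p.1 p.2)) (Ioo (0 : ℝ) 1 ×ˢ Ioo (-π) π) := by
  refine hF.comp ?_ fun p hp => circleMap_mem_unitBall hp.1 _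
  simp only [circleMap_zero]
  fun_prop

theorem continuous_comp_circleMap {E : Type*} [TopologicalSpace E] {F : ℂ → E}
    (hF : ContinuousOn F (Metric.ball 0 1)) {r : ℝ} (hr : r ∈ Ioo (0 : ℝ) 1) :
    Continuous (fun θ => F (circleMap 0 r θ)) :=
  hF.comp_continuous (continuous_circleMap 0 r) fun θ => circleMap_mem_unitBall hr θ

open Real in
theorem setLIntegral_ball_eq_circleAverage {F : ℂ → ℝ} (hF : ContinuousOn F (Metric.ball 0 1))
    (h0 : ∀ z, 0 ≤ F z) :
    ∫⁻ z in Metric.ball 0 1, ENNReal.ofReal (F z) =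
      ∫⁻ r in Ioo (0 : ℝ) 1, ENNReal.ofReal (2 * π * (r * circleAverage F 0 r)) := by
  rw [setLIntegral_ball_eq_polar, Measure.volume_eq_prod, ← Measure.prod_restrict, lintegral_prod]
  · refine setLIntegral_congr_fun measurableSet_Ioo fun r hr => ?_
    dsimp only
    rw [lintegral_const_mul' _ _ ENNReal.ofReal_ne_top, ← ofReal_integral_eq_lintegral_ofReal,
      integral_Ioo_circleMap, ← ENNReal.ofReal_mul hr.1.le]
    · congr 1; rw [smul_eq_mul]; ring
    · exact ((continuous_comp_circleMap hF hr).integrableOn_Icc (a := -π) (b := π)).mono_set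
        Ioo_subset_Icc_self
    · exact .of_forall fun _ => h0 _
  · rw [Measure.prod_restrict, ← Measure.volume_eq_prod]
    refine ContinuousOn.aemeasurable ?_ (measurableSet_Ioo.prod measurableSet_Ioo)
    simp_rw [fun p : ℝ × ℝ => (ENNReal.ofReal_mul' (p := p.1) (h0 (circleMap 0 p.1 p.2))).symm]
    exact ENNReal.continuous_ofReal.comp_continuousOn
      (continuous_fst.continuousOn.mul (continuousOn_comp_circleMap_prod hF))

open Real in
theorem setIntegral_ball_eq_circleAverage {F : ℂ → ℂ} (hF : ContinuousOn F (Metric.ball 0 1))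
    (hi : IntegrableOn F (Metric.ball 0 1)) :
    ∫ z in Metric.ball 0 1, F z = ∫ r in (0 : ℝ)..1, (2 * π * r) • circleAverage F 0 r := by
  have hT : MeasurableSet (Ioo (0 : ℝ) 1 ×ˢ Ioo (-π) π) := measurableSet_Ioo.prod measurableSet_Ioo
  rw [setIntegral_ball_eq_polar, Measure.volume_eq_prod, setIntegral_prod,
    intervalIntegral.integral_of_le zero_le_one, integral_Ioc_eq_integral_Ioo]
  · refine setIntegral_congr_fun measurableSet_Ioo fun r hr => ?_
    dsimp only
    rw [integral_smul, integral_Ioo_circleMap, smul_smul]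
    congr 1; ring
  · refine ⟨?_, ?_⟩
    · exact (continuous_fst.continuousOn.smul
        (continuousOn_comp_circleMap_prod hF)).aestronglyMeasurable hT
    · have h := hi.2
      rw [HasFiniteIntegral, setLIntegral_ball_eq_polar] at h
      rw [HasFiniteIntegral, ← Measure.volume_eq_prod]
      refine lt_of_eq_of_lt (setLIntegral_congr_fun hT fun p hp => ?_) h
      rw [enorm_smul, Real.enorm_of_nonneg hp.1.1.le]

/-! ### The reproducing formula on the unit disc -/

/-- The Bergman kernel of the unit disc: `diskKernel a z` is `(π (1 - a z̄)²)⁻¹`, holomorphic in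
`a` and antiholomorphic in `z`, so that `f a = ∫ f z * diskKernel a z`. -/
noncomputable def diskKernel (a z : ℂ) : ℂ :=
  ((Real.pi : ℂ) * (1 - a * (starRingEnd ℂ) z) ^ 2)⁻¹

theorem conj_diskKernel (a z : ℂ) : (starRingEnd ℂ) (diskKernel a z) = diskKernel z a := by
  simp [diskKernel, mul_comm]

theorem diskKernel_self (a : ℂ) :
    diskKernel a a = (((Real.pi * (1 - ‖a‖ ^ 2) ^ 2)⁻¹ : ℝ) : ℂ) := by
  rw [diskKernel, Complex.mul_conj, Complex.normSq_eq_norm_sq]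
  push_cast
  rfl

theorem one_sub_norm_le_norm_one_sub_mul_conj {a z : ℂ} (hz : ‖z‖ ≤ 1) :
    1 - ‖a‖ ≤ ‖1 - a * (starRingEnd ℂ) z‖ := by
  have h1 := norm_sub_norm_le (1 : ℂ) (a * (starRingEnd ℂ) z)
  have h2 : ‖a * (starRingEnd ℂ) z‖ ≤ ‖a‖ := by
    rw [norm_mul, RCLike.norm_conj]
    exact mul_le_of_le_one_right (norm_nonneg _) hz
  rw [norm_one] at h1
  linarith

theorem one_sub_mul_conj_ne_zero {a z : ℂ} (ha : ‖a‖ < 1) (hz : ‖z‖ ≤ 1) :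
    1 - a * (starRingEnd ℂ) z ≠ 0 := by
  have := one_sub_norm_le_norm_one_sub_mul_conj (a := a) hz
  exact norm_pos_iff.1 (by linarith)

theorem norm_diskKernel_le {a z : ℂ} {r : ℝ} (ha : ‖a‖ ≤ r) (hr : r < 1) (hz : ‖z‖ ≤ 1) :
    ‖diskKernel a z‖ ≤ (Real.pi * (1 - r) ^ 2)⁻¹ := by
  have h := one_sub_norm_le_norm_one_sub_mul_conj (a := a) hz
  have hpi := Real.pi_pos
  rw [diskKernel, norm_inv, norm_mul, norm_pow, Complex.norm_real, Real.norm_of_nonneg hpi.le]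
  have : 0 < 1 - r := by linarith
  gcongr
  linarith

theorem continuousOn_diskKernel {a : ℂ} (ha : ‖a‖ < 1) :
    ContinuousOn (diskKernel a) (Metric.closedBall 0 1) := by
  refine ContinuousOn.inv₀ (by fun_prop) fun z hz => ?_
  have := one_sub_mul_conj_ne_zero ha (mem_closedBall_zero_iff.1 hz)
  exact mul_ne_zero (by exact_mod_cast Real.pi_ne_zero) (pow_ne_zero _ this)

theorem differentiableOn_diskKernel {z : ℂ} (hz : ‖z‖ ≤ 1) :
    DifferentiableOn ℂ (fun a => diskKernel a z) (Metric.ball 0 1) := by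
  refine DifferentiableOn.inv (by fun_prop) fun a ha => ?_
  have := one_sub_mul_conj_ne_zero (mem_ball_zero_iff.1 ha) hz
  exact mul_ne_zero (by exact_mod_cast Real.pi_ne_zero) (pow_ne_zero _ this)

open Real in
/-- On the circle of radius `r` one has `z̄ = r² / z`, which turns the average against the kernel
into Cauchy's formula for the derivative of `z * f z` at `a r²`. -/
theorem circleAverage_mul_diskKernel {f : ℂ → ℂ} (hf : DifferentiableOn ℂ f (Metric.ball 0 1))
    {a : ℂ} (ha : ‖a‖ < 1) {r : ℝ} (hr : r ∈ Ioo (0 : ℝ) 1) :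
    circleAverage (fun z => f z * diskKernel a z) 0 r =
      (π : ℂ)⁻¹ * (f (a * r ^ 2) + a * r ^ 2 * deriv f (a * r ^ 2)) := by
  have hr0 := hr.1
  have hw : a * (r : ℂ) ^ 2 ∈ Metric.ball (0 : ℂ) r := by
    rw [mem_ball_zero_iff, norm_mul, norm_pow, Complex.norm_real, norm_of_nonneg hr0.le]
    nlinarith [hr.2, norm_nonneg a]
  have hw1 : a * (r : ℂ) ^ 2 ∈ Metric.ball (0 : ℂ) 1 :=
    Metric.ball_subset_ball hr.2.le hw
  have hd : DifferentiableAt ℂ f (a * r ^ 2) :=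
    hf.differentiableAt (Metric.isOpen_ball.mem_nhds hw1)
  have key := Complex.two_pi_I_inv_smul_circleIntegral_sub_sq_inv_smul_of_differentiable
    (f := fun z => z * f z) Metric.isOpen_ball (Metric.closedBall_subset_ball hr.2)
    (differentiableOn_id.mul hf) hw
  have hder : deriv (fun z => z * f z) (a * r ^ 2) =
      f (a * r ^ 2) + a * r ^ 2 * deriv f (a * r ^ 2) := by
    have := ((hasDerivAt_id (a * (r : ℂ) ^ 2)).mul hd.hasDerivAt).deriv
    simpa [Pi.mul_def] using this
  rw [circleAverage_eq_circleIntegral hr0.ne', ← hder, ← key, smul_eq_mul, smul_eq_mul,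
    mul_left_comm, ← circleIntegral.integral_const_mul (π : ℂ)⁻¹ _ 0 r]
  congr 1
  refine circleIntegral.integral_congr hr0.le fun z hz => ?_
  have hzr : ‖z‖ = r := by simpa using hz
  have hz0 : z ≠ 0 := norm_pos_iff.1 (by rw [hzr]; exact hr0)
  have hzz : z * (starRingEnd ℂ) z = (r : ℂ) ^ 2 := by
    rw [Complex.mul_conj, Complex.normSq_eq_norm_sq, hzr]; push_cast; rfl
  have h1 := one_sub_mul_conj_ne_zero (z := z) ha (by rw [hzr]; exact hr.2.le)
  have h2 : z - a * (r : ℂ) ^ 2 = z * (1 - a * (starRingEnd ℂ) z) := by rw [← hzz]; ring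
  have := Real.pi_ne_zero
  simp only [diskKernel, h2, smul_eq_mul, sub_zero]
  field_simp

open Real in
/-- The Bergman reproducing formula on the disc, for integrable holomorphic functions. -/
theorem diskKernel_reproducing {f : ℂ → ℂ} (hf : DifferentiableOn ℂ f (Metric.ball 0 1))
    (hi : IntegrableOn f (Metric.ball 0 1)) {a : ℂ} (ha : ‖a‖ < 1) :
    ∫ z in Metric.ball 0 1, f z * diskKernel a z = f a := by
  have hk := (continuousOn_diskKernel ha).mono Metric.ball_subset_closedBall
  have hint : IntegrableOn (fun z => f z * diskKernel a z) (Metric.ball 0 1) := by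
    refine Integrable.mul_bdd (c := (π * (1 - ‖a‖) ^ 2)⁻¹) hi
      (hk.aestronglyMeasurable Metric.isOpen_ball.measurableSet) ?_
    filter_upwards [ae_restrict_mem Metric.isOpen_ball.measurableSet] with z hz
    exact norm_diskKernel_le le_rfl ha (mem_ball_zero_iff.1 hz).le
  rw [setIntegral_ball_eq_circleAverage (F := fun z => f z * diskKernel a z)
    (hf.continuousOn.mul hk) hint]
  have hmem : ∀ r ∈ Icc (0 : ℝ) 1, a * (r : ℂ) ^ 2 ∈ Metric.ball (0 : ℂ) 1 := fun r hr => by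
    rw [mem_ball_zero_iff, norm_mul, norm_pow, Complex.norm_real, norm_of_nonneg hr.1]
    nlinarith [hr.2, norm_nonneg a, hr.1, mul_le_one₀ hr.2 hr.1 hr.2]
  -- the radial integrand is the derivative of `r² f(a r²)`
  set G' : ℝ → ℂ := fun r => 2 * r * (f (a * r ^ 2) + a * r ^ 2 * deriv f (a * r ^ 2)) with hG'
  have hG : ∀ r ∈ uIcc (0 : ℝ) 1, HasDerivAt (fun r : ℝ => (r : ℂ) ^ 2 * f (a * r ^ 2))
      (G' r) r := by
    intro r hr
    rw [uIcc_of_le zero_le_one] at hr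
    have hd : HasDerivAt f (deriv f (a * r ^ 2)) (a * (r : ℂ) ^ 2) :=
      (hf.differentiableAt (Metric.isOpen_ball.mem_nhds (hmem r hr))).hasDerivAt
    have hsq : HasDerivAt (fun w : ℂ => w ^ 2) (2 * r) (r : ℂ) := by
      simpa using hasDerivAt_pow 2 (r : ℂ)
    have h := (hsq.mul (hd.comp (r : ℂ) (hsq.const_mul a))).comp_ofReal
    refine h.congr_deriv ?_
    simp only [hG', Function.comp_apply]
    ring
  have hG'c : ContinuousOn G' (uIcc (0 : ℝ) 1) := by
    rw [uIcc_of_le zero_le_one]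
    have e : ContinuousOn (fun r : ℝ => a * (r : ℂ) ^ 2) (Icc 0 1) := by fun_prop
    have e1 : ContinuousOn (fun r : ℝ => f (a * (r : ℂ) ^ 2)) (Icc 0 1) :=
      hf.continuousOn.comp e hmem
    have e2 : ContinuousOn (fun r : ℝ => deriv f (a * (r : ℂ) ^ 2)) (Icc 0 1) :=
      (hf.deriv Metric.isOpen_ball).continuousOn.comp e hmem
    simp only [hG']
    exact (continuous_const.mul Complex.continuous_ofReal).continuousOn.mul (e1.add (e.mul e2))
  have hcongr : ∀ᵐ r : ℝ, r ∈ uIoc (0 : ℝ) 1 →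
      (2 * π * r) • circleAverage (fun z => f z * diskKernel a z) 0 r = G' r := by
    have hne : ∀ᵐ r : ℝ, r ≠ 1 := by simp [ae_iff]
    filter_upwards [hne] with r hr1 hr
    rw [uIoc_of_le zero_le_one] at hr
    rw [circleAverage_mul_diskKernel hf ha ⟨hr.1, lt_of_le_of_ne hr.2 hr1⟩]
    have := Real.pi_ne_zero
    rw [Complex.real_smul]
    push_cast
    simp only [hG']
    field_simp
  rw [intervalIntegral.integral_congr_ae hcongr,
    intervalIntegral.integral_eq_sub_of_hasDerivAt hG hG'c.intervalIntegrable]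
  simp

/-! ### Littlewood subordination on the unit disc -/

/-- A quantitative consequence of the Schwarz–Pick lemma: the distance of `ψ z` to the unit circle
is at least a fixed multiple of that of `z`, depending only on a bound for `‖ψ 0‖`. -/
theorem norm_lt_one_sub_of_mapsTo_ball {ψ : ℂ → ℂ}
    (hψ : DifferentiableOn ℂ ψ (Metric.ball 0 1))
    (hm : MapsTo ψ (Metric.ball 0 1) (Metric.ball 0 1)) {r₀ : ℝ} (h0 : ‖ψ 0‖ ≤ r₀) (hr : r₀ < 1)
    {z : ℂ} (hz : ‖z‖ < 1) : ‖ψ z‖ < 1 - (1 - r₀) / 4 * (1 - ‖z‖) := by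
  set a := ψ 0 with ha
  have ha1 : ‖a‖ < 1 := lt_of_le_of_lt h0 hr
  -- the identity behind the Möbius transformation that exchanges `a` and `0`
  have hmob : ∀ w : ℂ, ‖1 - w * (starRingEnd ℂ) a‖ ^ 2 - ‖a - w‖ ^ 2 =
      (1 - ‖a‖ ^ 2) * (1 - ‖w‖ ^ 2) := fun w => by
    simp only [← Complex.normSq_eq_norm_sq, Complex.normSq_apply, Complex.sub_re, Complex.sub_im,
      Complex.mul_re, Complex.mul_im, Complex.conj_re, Complex.conj_im, Complex.one_re,
      Complex.one_im]
    ring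
  have hne : ∀ w : ℂ, ‖w‖ < 1 → 1 - w * (starRingEnd ℂ) a ≠ 0 := fun w hw =>
    one_sub_mul_conj_ne_zero hw ha1.le
  have hmem : ∀ {z : ℂ}, ‖z‖ < 1 → ‖ψ z‖ < 1 := fun hz => by
    simpa using hm (mem_ball_zero_iff.2 hz)
  have hσ : ‖(a - ψ z) / (1 - ψ z * (starRingEnd ℂ) a)‖ ≤ ‖z‖ := by
    refine Complex.norm_le_norm_of_mapsTo_ball (R := 1)
      (f := fun z => (a - ψ z) / (1 - ψ z * (starRingEnd ℂ) a)) ?_ ?_ (by simp [ha]) hz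
    · refine DifferentiableOn.div (by fun_prop) (by fun_prop) fun z hz => ?_
      exact hne _ (hmem (mem_ball_zero_iff.1 hz))
    · intro z hz
      have h1 := hmem (mem_ball_zero_iff.1 hz)
      have h2 := hmob (ψ z)
      have h3 : 0 < (1 - ‖a‖ ^ 2) * (1 - ‖ψ z‖ ^ 2) := by
        apply mul_pos <;> nlinarith [norm_nonneg a, norm_nonneg (ψ z)]
      rw [mem_closedBall_zero_iff, norm_div]
      refine div_le_one_of_le₀ ?_ (norm_nonneg _)
      exact (sq_le_sq₀ (norm_nonneg _) (norm_nonneg _)).1 (by linarith)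
  have hw := hmem hz
  have hd : 1 - ‖a‖ ≤ ‖1 - ψ z * (starRingEnd ℂ) a‖ := by
    have := one_sub_norm_le_norm_one_sub_mul_conj (a := a) hw.le
    have e : (starRingEnd ℂ) (1 - a * (starRingEnd ℂ) (ψ z)) = 1 - ψ z * (starRingEnd ℂ) a := by
      simp [mul_comm]
    rwa [← e, RCLike.norm_conj]
  rw [norm_div, div_le_iff₀ (lt_of_lt_of_le (by linarith) hd)] at hσ
  have h2 := hmob (ψ z)
  have hsq : ‖a - ψ z‖ ^ 2 ≤ (‖z‖ * ‖1 - ψ z * (starRingEnd ℂ) a‖) ^ 2 := by gcongr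
  have hna := norm_nonneg a
  have hnz := norm_nonneg z
  have hnw := norm_nonneg (ψ z)
  have h3 : (1 - ‖z‖ ^ 2) * (1 - ‖a‖) ^ 2 ≤ (1 - ‖a‖ ^ 2) * (1 - ‖ψ z‖ ^ 2) := by
    have : (1 - ‖z‖ ^ 2) * (1 - ‖a‖) ^ 2 ≤ (1 - ‖z‖ ^ 2) * ‖1 - ψ z * (starRingEnd ℂ) a‖ ^ 2 := by
      have : 0 ≤ 1 - ‖z‖ ^ 2 := by nlinarith
      gcongr
    nlinarith
  have h4 : (1 - ‖z‖ ^ 2) * (1 - ‖a‖) ≤ (1 + ‖a‖) * (1 - ‖ψ z‖ ^ 2) := by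
    refine le_of_mul_le_mul_left ?_ (show 0 < 1 - ‖a‖ by linarith)
    nlinarith
  have h5 : (1 - ‖z‖) * (1 - ‖a‖) ≤ (1 - ‖z‖ ^ 2) * (1 - ‖a‖) := by
    have : 0 ≤ 1 - ‖a‖ := by linarith
    gcongr
    nlinarith
  have h6 : (1 - ‖z‖) * (1 - r₀) ≤ (1 - ‖z‖) * (1 - ‖a‖) := by
    have : 0 ≤ 1 - ‖z‖ := by linarith
    gcongr
  have h7 : (1 + ‖a‖) * (1 - ‖ψ z‖ ^ 2) < 2 * (1 - ‖ψ z‖ ^ 2) := by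
    have : 0 < 1 - ‖ψ z‖ ^ 2 := by nlinarith
    gcongr
    linarith
  nlinarith

open Real in
theorem circleAverage_swap {G : ℂ → ℂ → ℝ} {r ρ : ℝ}
    (hG : Continuous fun p : ℝ × ℝ => G (circleMap 0 r p.1) (circleMap 0 ρ p.2)) :
    circleAverage (fun z => circleAverage (G z) 0 ρ) 0 r =
      circleAverage (fun ζ => circleAverage (fun z => G z ζ) 0 r) 0 ρ := by
  simp only [circleAverage, intervalIntegral.integral_smul]
  congr 2
  simp only [intervalIntegral.integral_of_le two_pi_pos.le]
  refine integral_integral_swap ?_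
  rw [Measure.prod_restrict]
  exact (hG.integrableOn_Icc (a := (0, 0)) (b := (2 * π, 2 * π)) (μ := volume)).mono_set
    (by rw [← Icc_prod_Icc]; exact prod_mono Ioc_subset_Icc_self Ioc_subset_Icc_self)

open Real in
theorem norm_circleAverage_le_circleAverage_norm {f : ℂ → ℂ} {c : ℂ} {R : ℝ} :
    ‖circleAverage f c R‖ ≤ circleAverage (fun z => ‖f z‖) c R := by
  rw [circleAverage, circleAverage, norm_smul, smul_eq_mul,
    Real.norm_of_nonneg (by positivity)]
  gcongr
  exact intervalIntegral.norm_integral_le_integral_norm two_pi_pos.le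

open Real in
/-- The Poisson integral of `‖g‖²` is a majorant of `‖g‖²`, by the Poisson formula for `g²`. -/
theorem norm_sq_le_circleAverage_poisson {g : ℂ → ℂ}
    (hg : DifferentiableOn ℂ g (Metric.ball 0 1)) {ρ : ℝ} (hρ : ρ < 1) {w : ℂ} (hw : ‖w‖ < ρ) :
    ‖g w‖ ^ 2 ≤ circleAverage (fun ζ => ((ζ + w) / (ζ - w)).re * ‖g ζ‖ ^ 2) 0 ρ := by
  have hρ0 : 0 < ρ := lt_of_le_of_lt (norm_nonneg _) hw
  have hwb : w ∈ Metric.ball (0 : ℂ) ρ := mem_ball_zero_iff.2 hw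
  have hd : DiffContOnCl ℂ (fun z => g z ^ 2) (Metric.ball 0 ρ) :=
    (hg.pow 2).diffContOnCl_ball (Metric.closedBall_subset_ball hρ)
  have h := hd.circleAverage_re_herglotzRieszKernel_smul' hwb
  rw [← norm_pow, ← h]
  refine norm_circleAverage_le_circleAverage_norm.trans (le_of_eq ?_)
  refine circleAverage_congr_sphere fun ζ hζ => ?_
  rw [abs_of_pos hρ0] at hζ
  have h1 := le_re_herglotzRieszKernel hζ hwb
  simp only [sub_zero] at h1 ⊢
  rw [norm_smul, norm_pow, Real.norm_of_nonneg]
  exact le_trans (div_nonneg (by linarith) (by positivity)) h1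

open Real in
/-- Littlewood subordination on circles. If `ψ` maps the disc of radius `r` into the one of radius
`ρ`, the Poisson majorant of `‖g‖²` on the circle of radius `ρ` composed with `ψ` is harmonic, and
its average over the circle of radius `r` is its value at `ψ 0`, which Harnack's inequality
controls. -/
theorem circleAverage_norm_sq_comp_le {g ψ : ℂ → ℂ}
    (hg : DifferentiableOn ℂ g (Metric.ball 0 1)) (hψ : DifferentiableOn ℂ ψ (Metric.ball 0 1))
    {r ρ : ℝ} (hr : r ∈ Ioo (0 : ℝ) 1) (hρ1 : ρ < 1)
    (hm : ∀ z : ℂ, ‖z‖ ≤ r → ‖ψ z‖ < ρ) :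
    circleAverage (fun z => ‖g (ψ z)‖ ^ 2) 0 r ≤
      (ρ + ‖ψ 0‖) / (ρ - ‖ψ 0‖) * circleAverage (fun z => ‖g z‖ ^ 2) 0 ρ := by
  have hψ0 : ‖ψ 0‖ < ρ := hm 0 (by simpa using hr.1.le)
  have hρ0 : 0 < ρ := lt_of_le_of_lt (norm_nonneg _) hψ0
  have hcr : ∀ θ, ‖circleMap 0 r θ‖ = r := fun θ => by simp [abs_of_pos hr.1]
  have hcρ : ∀ θ, ‖circleMap 0 ρ θ‖ = ρ := fun θ => by simp [abs_of_pos hρ0]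
  have hψc : Continuous fun θ => ψ (circleMap 0 r θ) :=
    continuous_comp_circleMap hψ.continuousOn hr
  have hgc : Continuous fun θ => g (circleMap 0 ρ θ) :=
    continuous_comp_circleMap hg.continuousOn ⟨hρ0, hρ1⟩
  have hgψ : Continuous fun θ => g (ψ (circleMap 0 r θ)) :=
    hg.continuousOn.comp_continuous hψc fun θ =>
      mem_ball_zero_iff.2 ((hm _ (hcr θ).le).trans hρ1)
  have hne : ∀ z ζ : ℂ, ‖z‖ ≤ r → ‖ζ‖ = ρ → ζ - ψ z ≠ 0 := fun z ζ hz hζ h => by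
    have := hm z hz
    rw [← sub_eq_zero.1 h, hζ] at this
    exact lt_irrefl _ this
  have hGc : Continuous fun p : ℝ × ℝ =>
      ((circleMap 0 ρ p.2 + ψ (circleMap 0 r p.1)) /
        (circleMap 0 ρ p.2 - ψ (circleMap 0 r p.1))).re * ‖g (circleMap 0 ρ p.2)‖ ^ 2 := by
    have e1 := hψc.comp (continuous_fst (X := ℝ) (Y := ℝ))
    have e2 := hgc.comp (continuous_snd (X := ℝ) (Y := ℝ))
    have e3 := (continuous_circleMap 0 ρ).comp (continuous_snd (X := ℝ) (Y := ℝ))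
    simp only [Function.comp_def] at e1 e2 e3
    refine (Complex.continuous_re.comp ((e3.add e1).div (e3.sub e1) fun p => ?_)).mul
      (e2.norm.pow 2)
    exact hne _ _ (hcr _).le (hcρ _)
  have hmean : ∀ ζ : ℂ, ‖ζ‖ = ρ →
      circleAverage (fun z => ((ζ + ψ z) / (ζ - ψ z)).re) 0 r = ((ζ + ψ 0) / (ζ - ψ 0)).re := by
    intro ζ hζ
    have hd : DiffContOnCl ℂ (fun z => (ζ + ψ z) / (ζ - ψ z)) (Metric.ball 0 |r|) := by
      rw [abs_of_pos hr.1]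
      refine DifferentiableOn.diffContOnCl fun z hz => ?_
      rw [closure_ball _ hr.1.ne'] at hz ⊢
      have hz' := mem_closedBall_zero_iff.1 hz
      have hψz := (hψ z (mem_ball_zero_iff.2 (hz'.trans_lt hr.2))).mono
        (Metric.closedBall_subset_ball hr.2)
      exact (hψz.const_add ζ).div (hψz.const_sub ζ) (hne z ζ hz' hζ)
    have hci : CircleIntegrable (fun z => (ζ + ψ z) / (ζ - ψ z)) 0 r := by
      refine Continuous.intervalIntegrable ?_ _ _
      exact (continuous_const.add hψc).div (continuous_const.sub hψc)
        fun θ => hne _ _ (hcr θ).le hζ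
    have := Complex.reCLM.circleAverage_comp_comm hci
    rw [hd.circleAverage] at this
    exact this
  calc circleAverage (fun z => ‖g (ψ z)‖ ^ 2) 0 r
      ≤ circleAverage (fun z => circleAverage
          (fun ζ => ((ζ + ψ z) / (ζ - ψ z)).re * ‖g ζ‖ ^ 2) 0 ρ) 0 r := by
        refine circleAverage_mono ((hgψ.norm.pow 2).intervalIntegrable _ _) ?_ fun z hz => ?_
        · refine Continuous.intervalIntegrable ?_ _ _
          simp only [circleAverage]
          refine continuous_const.mul ?_
          exact intervalIntegral.continuous_parametric_intervalIntegral_of_continuous' hGc 0 (2 * π)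
        · rw [abs_of_pos hr.1, mem_sphere_zero_iff_norm] at hz
          exact norm_sq_le_circleAverage_poisson hg hρ1 (hm z hz.le)
    _ = circleAverage (fun ζ => circleAverage
          (fun z => ((ζ + ψ z) / (ζ - ψ z)).re * ‖g ζ‖ ^ 2) 0 r) 0 ρ :=
        circleAverage_swap (G := fun z ζ => ((ζ + ψ z) / (ζ - ψ z)).re * ‖g ζ‖ ^ 2) hGc
    _ = circleAverage (fun ζ => ((ζ + ψ 0) / (ζ - ψ 0)).re * ‖g ζ‖ ^ 2) 0 ρ := by
        refine circleAverage_congr_sphere fun ζ hζ => ?_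
        rw [abs_of_pos hρ0, mem_sphere_zero_iff_norm] at hζ
        have := circleAverage_fun_smul (a := ‖g ζ‖ ^ 2) (c := 0) (R := r)
          (f := fun z => ((ζ + ψ z) / (ζ - ψ z)).re)
        simp only [smul_eq_mul, mul_comm (‖g ζ‖ ^ 2)] at this
        rw [this, hmean ζ hζ]
    _ ≤ circleAverage (fun ζ => ((ρ + ‖ψ 0‖) / (ρ - ‖ψ 0‖)) * ‖g ζ‖ ^ 2) 0 ρ := by
        refine circleAverage_mono ?_ ?_ fun ζ hζ => ?_
        · refine Continuous.intervalIntegrable ?_ _ _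
          refine (Complex.continuous_re.comp (((continuous_circleMap 0 ρ).add
            continuous_const).div ((continuous_circleMap 0 ρ).sub continuous_const)
            fun θ => ?_)).mul (hgc.norm.pow 2)
          exact hne _ _ (by simpa using hr.1.le) (hcρ θ)
        · exact (continuous_const.mul (hgc.norm.pow 2)).intervalIntegrable _ _
        · rw [abs_of_pos hρ0] at hζ
          have := re_herglotzRieszKernel_le hζ (mem_ball_zero_iff.2 hψ0)
          simp only [sub_zero] at this
          gcongr
    _ = _ := by
        have := circleAverage_fun_smul (a := (ρ + ‖ψ 0‖) / (ρ - ‖ψ 0‖)) (c := 0) (R := ρ)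
          (f := fun ζ => ‖g ζ‖ ^ 2)
        simpa only [smul_eq_mul] using this

open Real in
/-- Littlewood subordination for the Bergman space of the disc, with a constant that depends only
on a bound for `‖ψ 0‖`. -/
theorem lintegral_norm_sq_comp_le {g ψ : ℂ → ℂ}
    (hg : DifferentiableOn ℂ g (Metric.ball 0 1)) (hψ : DifferentiableOn ℂ ψ (Metric.ball 0 1))
    (hm : MapsTo ψ (Metric.ball 0 1) (Metric.ball 0 1)) {r₀ : ℝ} (h0 : ‖ψ 0‖ ≤ r₀) (hr : r₀ < 1) :
    ∫⁻ z in Metric.ball 0 1, ENNReal.ofReal (‖g (ψ z)‖ ^ 2) ≤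
      ENNReal.ofReal (16 / (1 - r₀) ^ 2) *
        ∫⁻ z in Metric.ball 0 1, ENNReal.ofReal (‖g z‖ ^ 2) := by
  have hr0 : 0 ≤ r₀ := (norm_nonneg _).trans h0
  -- `ψ` maps the disc of radius `r` into the one of radius `ρ r`, which is affine in `r`
  set c := (1 - r₀) / 4 with hc
  have hc0 : 0 < c := by rw [hc]; linarith
  have hc1 : c ≤ 1 / 4 := by rw [hc]; linarith
  set ρ : ℝ → ℝ := fun r => 1 - c * (1 - r) with hρ
  rw [setLIntegral_ball_eq_circleAverage (F := fun z => ‖g (ψ z)‖ ^ 2)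
      ((hg.continuousOn.comp hψ.continuousOn hm).norm.pow 2) (fun _ => by positivity),
    setLIntegral_ball_eq_circleAverage (F := fun z => ‖g z‖ ^ 2)
      (hg.continuousOn.norm.pow 2) (fun _ => by positivity)]
  set H : ℝ → ENNReal := fun r =>
    ENNReal.ofReal (2 * π * (r * circleAverage (fun z => ‖g z‖ ^ 2) 0 r)) with hH
  have hA : ∀ r, 0 ≤ circleAverage (fun z => ‖g z‖ ^ 2) 0 r := fun r =>
    circleAverage_nonneg_of_nonneg fun _ _ => by positivity
  have hcv := lintegral_image_eq_lintegral_abs_deriv_mul (f := ρ) (f' := fun _ => c)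
    (s := Ioo (0 : ℝ) 1) measurableSet_Ioo (fun x _ => by
      have := (((hasDerivAt_id x).const_sub 1).const_mul c).const_sub 1
      simpa using this.hasDerivWithinAt) (fun x _ y _ hxy => by
      have : c * (1 - x) = c * (1 - y) := by simpa [hρ] using hxy
      have := mul_left_cancel₀ hc0.ne' this
      linarith) H
  have himg : ρ '' Ioo (0 : ℝ) 1 ⊆ Ioo (0 : ℝ) 1 := by
    rintro _ ⟨r, hr, rfl⟩
    simp only [hρ, mem_Ioo]
    constructor <;> nlinarith [hr.1, hr.2]
  have hK : (16 / (1 - r₀) ^ 2) = (4 / (1 - r₀)) / c := by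
    rw [hc]; field_simp; norm_num
  calc ∫⁻ r in Ioo (0 : ℝ) 1,
        ENNReal.ofReal (2 * π * (r * circleAverage (fun z => ‖g (ψ z)‖ ^ 2) 0 r))
      ≤ ∫⁻ r in Ioo (0 : ℝ) 1, ENNReal.ofReal (16 / (1 - r₀) ^ 2) *
          (ENNReal.ofReal |c| * H (ρ r)) := by
        refine setLIntegral_mono' measurableSet_Ioo fun r hr' => ?_
        have hρr : ρ r = 1 - c * (1 - r) := rfl
        have h1 : circleAverage (fun z => ‖g (ψ z)‖ ^ 2) 0 r ≤
            (ρ r + ‖ψ 0‖) / (ρ r - ‖ψ 0‖) * circleAverage (fun z => ‖g z‖ ^ 2) 0 (ρ r) := by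
          refine circleAverage_norm_sq_comp_le hg hψ hr' (himg ⟨r, hr', rfl⟩).2 fun z hz => ?_
          have := norm_lt_one_sub_of_mapsTo_ball hψ hm h0 hr (hz.trans_lt hr'.2)
          rw [← hc] at this
          rw [hρr]
          nlinarith
        have h2 : (ρ r + ‖ψ 0‖) / (ρ r - ‖ψ 0‖) ≤ 4 / (1 - r₀) := by
          have hle : ρ r ≤ 1 := (himg ⟨r, hr', rfl⟩).2.le
          have hge : 3 / 4 * (1 - r₀) ≤ ρ r - ‖ψ 0‖ := by
            have : c * (1 - r) ≤ c := mul_le_of_le_one_right hc0.le (by linarith [hr'.1])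
            rw [hρr]
            linarith
          rw [div_le_div_iff₀ (by linarith) (by linarith)]
          nlinarith [norm_nonneg (ψ 0)]
        -- the weight `r` of polar coordinates may be replaced by the weight `ρ r`
        have h3 : r ≤ ρ r := by rw [hρr]; nlinarith [hr'.1, hr'.2]
        rw [abs_of_pos hc0, hH, ← ENNReal.ofReal_mul hc0.le, ← ENNReal.ofReal_mul (by positivity)]
        refine ENNReal.ofReal_le_ofReal ?_
        have h4 : r * circleAverage (fun z => ‖g (ψ z)‖ ^ 2) 0 r ≤
            ρ r * (4 / (1 - r₀) * circleAverage (fun z => ‖g z‖ ^ 2) 0 (ρ r)) := by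
          have := hA (ρ r)
          have : 0 ≤ circleAverage (fun z => ‖g (ψ z)‖ ^ 2) 0 r :=
            circleAverage_nonneg_of_nonneg fun _ _ => by positivity
          have hr0' := hr'.1
          have hρ0' := (himg ⟨r, hr', rfl⟩).1
          gcongr
          exact h1.trans (mul_le_mul_of_nonneg_right h2 (hA _))
        rw [hK]
        have h5 : 4 / (1 - r₀) / c * (c * (2 * π * (ρ r *
            circleAverage (fun z => ‖g z‖ ^ 2) 0 (ρ r)))) =
            2 * π * (ρ r * (4 / (1 - r₀) * circleAverage (fun z => ‖g z‖ ^ 2) 0 (ρ r))) := by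
          field_simp
        rw [h5]
        gcongr
    _ = ENNReal.ofReal (16 / (1 - r₀) ^ 2) * ∫⁻ r in ρ '' Ioo (0 : ℝ) 1, H r := by
        rw [hcv, lintegral_const_mul' _ _ ENNReal.ofReal_ne_top]
    _ ≤ ENNReal.ofReal (16 / (1 - r₀) ^ 2) * ∫⁻ r in Ioo (0 : ℝ) 1, H r := by
        gcongr

/-! ### The Bergman kernel of the bidisc -/

theorem bidisc_eq_ball : bidisc = Metric.ball (0 : ℂ × ℂ) 1 := by
  rw [bidisc, ball_prod_same]; rfl

theorem isOpen_bidisc : IsOpen bidisc := bidisc_eq_ball ▸ Metric.isOpen_ball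

theorem mem_bidisc {z : ℂ × ℂ} : z ∈ bidisc ↔ ‖z.1‖ < 1 ∧ ‖z.2‖ < 1 := by
  simp [bidisc]

instance isFiniteMeasure_restrict_bidisc : IsFiniteMeasure (volume.restrict bidisc) :=
  isFiniteMeasure_restrict.2 (by rw [bidisc_eq_ball]; exact measure_ball_lt_top.ne)

theorem restrict_bidisc : volume.restrict bidisc =
    ((volume : Measure ℂ).restrict (Metric.ball 0 1)).prod (volume.restrict (Metric.ball 0 1)) := by
  rw [bidisc, Measure.volume_eq_prod, Measure.prod_restrict]

theorem DifferentiableOn.slice_left {f : ℂ × ℂ → ℂ} (hf : DifferentiableOn ℂ f bidisc) {w : ℂ}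
    (hw : ‖w‖ < 1) : DifferentiableOn ℂ (fun z => f (z, w)) (Metric.ball 0 1) :=
  hf.comp (by fun_prop) fun z hz => mem_bidisc.2 ⟨mem_ball_zero_iff.1 hz, hw⟩

theorem DifferentiableOn.slice_right {f : ℂ × ℂ → ℂ} (hf : DifferentiableOn ℂ f bidisc) {w : ℂ}
    (hw : ‖w‖ < 1) : DifferentiableOn ℂ (fun z => f (w, z)) (Metric.ball 0 1) :=
  hf.comp (by fun_prop) fun z hz => mem_bidisc.2 ⟨hw, mem_ball_zero_iff.1 hz⟩

/-- The product of the kernels of the two discs, with the same convention as `diskKernel`: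
holomorphic in the first argument and antiholomorphic in the second. -/
noncomputable def bidiscKernel (a z : ℂ × ℂ) : ℂ := diskKernel a.1 z.1 * diskKernel a.2 z.2

theorem conj_bidiscKernel (a z : ℂ × ℂ) :
    (starRingEnd ℂ) (bidiscKernel a z) = bidiscKernel z a := by
  simp [bidiscKernel, conj_diskKernel]

/-- The product of `1 - ‖z_j‖²` over both coordinates; `K_z(z) = (π * bidiscWeight z)⁻²`. -/
noncomputable def bidiscWeight (z : ℂ × ℂ) : ℝ := (1 - ‖z.1‖ ^ 2) * (1 - ‖z.2‖ ^ 2)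

theorem bidiscWeight_pos {z : ℂ × ℂ} (hz : z ∈ bidisc) : 0 < bidiscWeight z := by
  have := mem_bidisc.1 hz
  have h1 := norm_nonneg z.1
  have h2 := norm_nonneg z.2
  apply mul_pos <;> nlinarith

theorem bidiscKernel_self (z : ℂ × ℂ) :
    bidiscKernel z z = (((Real.pi * bidiscWeight z)⁻¹ ^ 2 : ℝ) : ℂ) := by
  rw [bidiscKernel, diskKernel_self, diskKernel_self, bidiscWeight]
  push_cast
  rw [inv_pow, ← mul_inv]
  congr 1
  ring

theorem norm_bidiscKernel_le {a z : ℂ × ℂ} {r : ℝ} (ha : ‖a‖ ≤ r) (hr : r < 1) (hz : ‖z‖ ≤ 1) :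
    ‖bidiscKernel a z‖ ≤ (Real.pi * (1 - r) ^ 2)⁻¹ ^ 2 := by
  rw [bidiscKernel, norm_mul, sq]
  have h1 := norm_diskKernel_le ((norm_fst_le a).trans ha) hr ((norm_fst_le z).trans hz)
  have h2 := norm_diskKernel_le ((norm_snd_le a).trans ha) hr ((norm_snd_le z).trans hz)
  gcongr

theorem norm_lt_one_of_mem_bidisc {z : ℂ × ℂ} (hz : z ∈ bidisc) : ‖z‖ < 1 := by
  rwa [bidisc_eq_ball, mem_ball_zero_iff] at hz

theorem measurable_diskKernel (a : ℂ) : Measurable (diskKernel a) := by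
  unfold diskKernel; fun_prop

theorem measurable_bidiscKernel (a : ℂ × ℂ) : Measurable (bidiscKernel a) :=
  ((measurable_diskKernel _).comp measurable_fst).mul
    ((measurable_diskKernel _).comp measurable_snd)

theorem integrable_mul_bidiscKernel {F : ℂ × ℂ → ℂ} (hF : IntegrableOn F bidisc) {a : ℂ × ℂ}
    (ha : a ∈ bidisc) : IntegrableOn (fun z => F z * bidiscKernel a z) bidisc := by
  refine Integrable.mul_bdd (c := (Real.pi * (1 - ‖a‖) ^ 2)⁻¹ ^ 2) hF
    (measurable_bidiscKernel a).aestronglyMeasurable ?_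
  filter_upwards [ae_restrict_mem isOpen_bidisc.measurableSet] with z hz
  exact norm_bidiscKernel_le le_rfl (norm_lt_one_of_mem_bidisc ha)
    (norm_lt_one_of_mem_bidisc hz).le

/-- The reproducing formula on the bidisc: Fubini and the formula on the disc in each variable. -/
theorem bidiscKernel_reproducing {f : ℂ × ℂ → ℂ} (hf : DifferentiableOn ℂ f bidisc)
    (hi : IntegrableOn f bidisc) {a : ℂ × ℂ} (ha : a ∈ bidisc) :
    ∫ z in bidisc, f z * bidiscKernel a z = f a := by
  have ha' := mem_bidisc.1 ha
  have hint := integrable_mul_bidiscKernel hi ha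
  rw [IntegrableOn, restrict_bidisc] at hi
  rw [IntegrableOn, restrict_bidisc] at hint
  have hball : MeasurableSet (Metric.ball (0 : ℂ) 1) := Metric.isOpen_ball.measurableSet
  have hinner : (fun w => ∫ z in Metric.ball 0 1, f (z, w) * bidiscKernel a (z, w)) =ᵐ[
      volume.restrict (Metric.ball 0 1)] fun w => f (a.1, w) * diskKernel a.2 w := by
    filter_upwards [hi.prod_left_ae, ae_restrict_mem hball] with w hw hwb
    have h1 := diskKernel_reproducing (hf.slice_left (mem_ball_zero_iff.1 hwb)) hw ha'.1
    simp only [bidiscKernel, ← mul_assoc]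
    rw [integral_mul_const, h1]
  rw [restrict_bidisc, integral_prod_symm _ hint, integral_congr_ae hinner]
  have hs : IntegrableOn (fun w => f (a.1, w)) (Metric.ball 0 1) := by
    have hK : Integrable (fun p : ℂ × ℂ => f p * diskKernel a.1 p.1)
        (((volume : Measure ℂ).restrict (Metric.ball 0 1)).prod
          (volume.restrict (Metric.ball 0 1))) := by
      refine Integrable.mul_bdd (c := (Real.pi * (1 - ‖a.1‖) ^ 2)⁻¹) hi
        ((measurable_diskKernel _).comp measurable_fst).aestronglyMeasurable ?_
      rw [← restrict_bidisc]
      filter_upwards [ae_restrict_mem isOpen_bidisc.measurableSet] with z hz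
      exact norm_diskKernel_le le_rfl ha'.1 (mem_bidisc.1 hz).1.le
    refine hK.integral_prod_right.congr ?_
    filter_upwards [hi.prod_left_ae, ae_restrict_mem hball] with w hw hwb
    exact diskKernel_reproducing (hf.slice_left (mem_ball_zero_iff.1 hwb)) hw ha'.1
  exact diskKernel_reproducing (hf.slice_right ha'.1) hs ha'.2

theorem MemBergman.integrableOn {f : ℂ × ℂ → ℂ} (hf : MemBergman bidisc f) :
    IntegrableOn f bidisc := hf.2.integrable one_le_two

theorem differentiableOn_bidiscKernel {z : ℂ × ℂ} (hz : ‖z‖ ≤ 1) :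
    DifferentiableOn ℂ (fun a => bidiscKernel a z) bidisc := by
  have h1 := (differentiableOn_diskKernel ((norm_fst_le z).trans hz)).comp
    (differentiableOn_fst (𝕜 := ℂ) (s := bidisc)) fun a ha => ha.1
  have h2 := (differentiableOn_diskKernel ((norm_snd_le z).trans hz)).comp
    (differentiableOn_snd (𝕜 := ℂ) (s := bidisc)) fun a ha => ha.2
  exact h1.mul h2

theorem norm_bidiscKernel_le' {a z : ℂ × ℂ} (ha : a ∈ bidisc) (hz : z ∈ bidisc) :
    ‖bidiscKernel z a‖ ≤ (Real.pi * (1 - ‖a‖) ^ 2)⁻¹ ^ 2 := by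
  rw [← conj_bidiscKernel, RCLike.norm_conj]
  exact norm_bidiscKernel_le le_rfl (norm_lt_one_of_mem_bidisc ha) (norm_lt_one_of_mem_bidisc hz).le

theorem memBergman_bidiscKernel {a : ℂ × ℂ} (ha : a ∈ bidisc) :
    MemBergman bidisc (fun z => bidiscKernel z a) := by
  have hd := differentiableOn_bidiscKernel (norm_lt_one_of_mem_bidisc ha).le
  refine ⟨hd, MemLp.of_bound (hd.continuousOn.aestronglyMeasurable isOpen_bidisc.measurableSet)
    ((Real.pi * (1 - ‖a‖) ^ 2)⁻¹ ^ 2) ?_⟩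
  filter_upwards [ae_restrict_mem isOpen_bidisc.measurableSet] with z hz
  exact norm_bidiscKernel_le' ha hz

theorem isBergmanKernelAt_bidiscKernel {a : ℂ × ℂ} (ha : a ∈ bidisc) :
    IsBergmanKernelAt bidisc a (fun z => bidiscKernel z a) := by
  refine ⟨memBergman_bidiscKernel ha, fun f hf => ?_⟩
  simp only [conj_bidiscKernel]
  exact (bidiscKernel_reproducing hf.1 hf.integrableOn ha).symm

/-- The kernel chosen in `bergmanKernel` is the explicit one: two representing functions reproduce
each other. -/
theorem bergmanKernel_bidisc {a z : ℂ × ℂ} (ha : a ∈ bidisc) (hz : z ∈ bidisc) :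
    bergmanKernel bidisc a z = bidiscKernel z a := by
  have hex : ∃ k, IsBergmanKernelAt bidisc a k := ⟨_, isBergmanKernelAt_bidiscKernel ha⟩
  have hk := hex.choose_spec
  rw [bergmanKernel, dif_pos hex]
  set k := hex.choose
  have h1 := hk.2 _ (memBergman_bidiscKernel hz)
  have h2 := (isBergmanKernelAt_bidiscKernel hz).2 k hk.1
  rw [h2, ← conj_bidiscKernel, h1, ← integral_conj]
  congr 1
  ext w
  simp [mul_comm]

/-- The ratio in the compactness criterion is the square of a ratio of weights. -/
theorem bergmanKernel_ratio {z w : ℂ × ℂ} (hz : z ∈ bidisc) (hw : w ∈ bidisc) :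
    bergmanKernel bidisc w w / bergmanKernel bidisc z z =
      (((bidiscWeight z / bidiscWeight w) ^ 2 : ℝ) : ℂ) := by
  rw [bergmanKernel_bidisc hw hw, bergmanKernel_bidisc hz hz, bidiscKernel_self, bidiscKernel_self,
    ← Complex.ofReal_div]
  congr 1
  have := bidiscWeight_pos hz
  have := bidiscWeight_pos hw
  have := Real.pi_pos
  field_simp

theorem tendsto_bergmanKernel_ratio_iff {φ : ℂ × ℂ → ℂ × ℂ} (hm : MapsTo φ bidisc bidisc)
    {l : Filter (ℂ × ℂ)} (hl : l ≤ 𝓟 bidisc) :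
    Tendsto (fun z => bergmanKernel bidisc (φ z) (φ z) / bergmanKernel bidisc z z) l (𝓝 0) ↔
      Tendsto (fun z => bidiscWeight z / bidiscWeight (φ z)) l (𝓝 0) := by
  have hmem : ∀ᶠ z in l, z ∈ bidisc := hl (mem_principal_self _)
  have hc : (fun z => bergmanKernel bidisc (φ z) (φ z) / bergmanKernel bidisc z z) =ᶠ[l]
      fun z => (((bidiscWeight z / bidiscWeight (φ z)) ^ 2 : ℝ) : ℂ) := by
    filter_upwards [hmem] with z hz
    exact bergmanKernel_ratio hz (hm hz)
  rw [tendsto_congr' hc, ← Complex.ofReal_zero, tendsto_ofReal_iff]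
  constructor
  · intro h
    have := (Real.continuous_sqrt.tendsto 0).comp h
    rw [Real.sqrt_zero] at this
    refine this.congr' ?_
    filter_upwards [hmem] with z hz
    exact Real.sqrt_sq (div_nonneg (bidiscWeight_pos hz).le (bidiscWeight_pos (hm hz)).le)
  · intro h
    simpa using h.pow 2

/-- Evaluation of a square integrable holomorphic function on a smaller concentric disc. The
reproducing formula is applied to `g²`. -/
theorem norm_sq_le_lintegral_ball {g : ℂ → ℂ} (hg : DifferentiableOn ℂ g (Metric.ball 0 1))
    {r : ℝ} (hr : r < 1) {w : ℂ} (hw : ‖w‖ ≤ r) :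
    ENNReal.ofReal (‖g w‖ ^ 2) ≤ ENNReal.ofReal (Real.pi * (1 - r) ^ 2)⁻¹ *
      ∫⁻ z in Metric.ball 0 1, ENNReal.ofReal (‖g z‖ ^ 2) := by
  have hM : 0 < (Real.pi * (1 - r) ^ 2)⁻¹ := by
    have := Real.pi_pos
    have : 0 < 1 - r := by linarith
    positivity
  by_cases htop : ∫⁻ z in Metric.ball 0 1, ENNReal.ofReal (‖g z‖ ^ 2) = ⊤
  · rw [htop, ENNReal.mul_top (by simpa using hM)]
    exact le_top
  have hball : MeasurableSet (Metric.ball (0 : ℂ) 1) := Metric.isOpen_ball.measurableSet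
  have hg2 : DifferentiableOn ℂ (fun z => g z ^ 2) (Metric.ball 0 1) := hg.pow 2
  have hi : IntegrableOn (fun z => g z ^ 2) (Metric.ball 0 1) := by
    refine ⟨hg2.continuousOn.aestronglyMeasurable hball, ?_⟩
    refine lt_of_eq_of_lt (lintegral_congr fun z => ?_) (lt_top_iff_ne_top.2 htop)
    rw [← ofReal_norm, norm_pow]
  rw [← norm_pow, ← diskKernel_reproducing hg2 hi (hw.trans_lt hr), ofReal_norm]
  refine (enorm_integral_le_lintegral_enorm _).trans ?_
  rw [← lintegral_const_mul' _ _ ENNReal.ofReal_ne_top]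
  refine setLIntegral_mono' hball fun z hz => ?_
  rw [← ofReal_norm, ← ENNReal.ofReal_mul hM.le, norm_mul, norm_pow, mul_comm]
  have := norm_diskKernel_le hw hr (mem_ball_zero_iff.1 hz).le
  gcongr

/-! ### Completeness of the Bergman space of the bidisc -/

theorem hasDerivAt_diskKernel {a z : ℂ} (ha : ‖a‖ < 1) (hz : ‖z‖ ≤ 1) :
    HasDerivAt (fun a => diskKernel a z)
      (2 * Real.pi * (starRingEnd ℂ) z * (1 - a * (starRingEnd ℂ) z) * diskKernel a z ^ 2) a := by
  have h0 := one_sub_mul_conj_ne_zero ha hz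
  have hpi : (Real.pi : ℂ) ≠ 0 := by exact_mod_cast Real.pi_ne_zero
  have h1 : HasDerivAt (fun a : ℂ => (Real.pi : ℂ) * (1 - a * (starRingEnd ℂ) z) ^ 2)
      (Real.pi * (2 * (1 - a * (starRingEnd ℂ) z) * (-(starRingEnd ℂ) z))) a := by
    have := ((((hasDerivAt_id a).mul_const ((starRingEnd ℂ) z)).const_sub 1).pow 2).const_mul
      (Real.pi : ℂ)
    simpa using this
  refine (h1.inv (mul_ne_zero hpi (pow_ne_zero _ h0))).congr_deriv ?_
  rw [diskKernel]
  field_simp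

theorem norm_deriv_diskKernel_le {a z : ℂ} {r : ℝ} (ha : ‖a‖ ≤ r) (hr : r < 1) (hz : ‖z‖ ≤ 1) :
    ‖2 * Real.pi * (starRingEnd ℂ) z * (1 - a * (starRingEnd ℂ) z) * diskKernel a z ^ 2‖ ≤
      4 * Real.pi * (Real.pi * (1 - r) ^ 2)⁻¹ ^ 2 := by
  have h1 := norm_diskKernel_le ha hr hz
  have h2 : ‖1 - a * (starRingEnd ℂ) z‖ ≤ 2 := by
    refine (norm_sub_le _ _).trans ?_
    rw [norm_one, norm_mul, RCLike.norm_conj]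
    nlinarith [norm_nonneg a, norm_nonneg z]
  have hpi := Real.pi_pos
  rw [norm_mul, norm_mul, norm_mul, norm_mul, norm_pow, RCLike.norm_conj, Complex.norm_real,
    Real.norm_of_nonneg hpi.le, Complex.norm_ofNat]
  calc 2 * Real.pi * ‖z‖ * ‖1 - a * (starRingEnd ℂ) z‖ * ‖diskKernel a z‖ ^ 2
      ≤ 2 * Real.pi * 1 * 2 * (Real.pi * (1 - r) ^ 2)⁻¹ ^ 2 := by gcongr
    _ = _ := by ring

/-- The Bergman projection of an integrable function is holomorphic, by differentiation under the
integral sign. -/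
theorem differentiableOn_integral_mul_bidiscKernel {F : ℂ × ℂ → ℂ} (hF : IntegrableOn F bidisc) :
    DifferentiableOn ℂ (fun a => ∫ z in bidisc, F z * bidiscKernel a z) bidisc := by
  intro a₀ ha₀
  obtain ⟨r, har, hr⟩ := exists_between (norm_lt_one_of_mem_bidisc ha₀)
  set d : ℂ → ℂ → ℂ := fun a z =>
    2 * Real.pi * (starRingEnd ℂ) z * (1 - a * (starRingEnd ℂ) z) * diskKernel a z ^ 2 with hd
  set D : ℂ × ℂ → ℂ × ℂ → (ℂ × ℂ →L[ℂ] ℂ) := fun a z =>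
    F z • ((diskKernel a.1 z.1 * d a.2 z.2) • ContinuousLinearMap.snd ℂ ℂ ℂ +
      (diskKernel a.2 z.2 * d a.1 z.1) • ContinuousLinearMap.fst ℂ ℂ ℂ) with hD
  set M := (Real.pi * (1 - r) ^ 2)⁻¹ with hM
  have hM0 : 0 ≤ M := by have := Real.pi_pos; positivity
  set C := M * (4 * Real.pi * M ^ 2) + M * (4 * Real.pi * M ^ 2) with hC
  have hmd : ∀ a, Measurable (d a) := fun a => by
    have := measurable_diskKernel a
    simp only [hd]
    fun_prop
  refine (hasFDerivAt_integral_of_dominated_of_fderiv_le (F' := D) (bound := fun z => ‖F z‖ * C)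
    (s := Metric.ball 0 r) (Metric.isOpen_ball.mem_nhds (mem_ball_zero_iff.2 har)) ?_ ?_ ?_ ?_ ?_
    ?_).differentiableAt.differentiableWithinAt
  · exact .of_forall fun a => hF.1.mul (measurable_bidiscKernel a).aestronglyMeasurable
  · exact integrable_mul_bidiscKernel hF ha₀
  · refine hF.1.smul (Measurable.aestronglyMeasurable ?_)
    have e1 := measurable_diskKernel a₀.1
    have e2 := measurable_diskKernel a₀.2
    have e3 := hmd a₀.1
    have e4 := hmd a₀.2
    refine Measurable.add (Measurable.smul_const ?_ _) (Measurable.smul_const ?_ _) <;> fun_prop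
  · filter_upwards [ae_restrict_mem isOpen_bidisc.measurableSet] with z hz a ha
    have ha' := (mem_ball_zero_iff.1 ha).le
    have hz' := mem_bidisc.1 hz
    have h1 := norm_diskKernel_le ((norm_fst_le a).trans ha') hr hz'.1.le
    have h2 := norm_diskKernel_le ((norm_snd_le a).trans ha') hr hz'.2.le
    have h3 := norm_deriv_diskKernel_le ((norm_fst_le a).trans ha') hr hz'.1.le
    have h4 := norm_deriv_diskKernel_le ((norm_snd_le a).trans ha') hr hz'.2.le
    simp only [hD]
    rw [norm_smul]
    refine mul_le_mul_of_nonneg_left ((norm_add_le _ _).trans ?_) (norm_nonneg _)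
    rw [norm_smul, norm_smul, norm_mul (diskKernel a.1 z.1), norm_mul (diskKernel a.2 z.2)]
    have h5 : ‖ContinuousLinearMap.snd ℂ ℂ ℂ‖ ≤ 1 := ContinuousLinearMap.norm_snd_le ..
    have h6 : ‖ContinuousLinearMap.fst ℂ ℂ ℂ‖ ≤ 1 := ContinuousLinearMap.norm_fst_le ..
    rw [hC]
    refine add_le_add ?_ ?_
    · refine (mul_le_of_le_one_right (by positivity) h5).trans ?_
      exact mul_le_mul h1 h4 (norm_nonneg _) hM0
    · refine (mul_le_of_le_one_right (by positivity) h6).trans ?_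
      exact mul_le_mul h2 h3 (norm_nonneg _) hM0
  · exact hF.norm.mul_const C
  · filter_upwards [ae_restrict_mem isOpen_bidisc.measurableSet] with z hz a ha
    have ha' := (mem_ball_zero_iff.1 ha).trans hr
    have hz' := mem_bidisc.1 hz
    have h1 := (hasDerivAt_diskKernel ((norm_fst_le a).trans_lt ha') hz'.1.le).comp_hasFDerivAt a
      (hasFDerivAt_fst (𝕜 := ℂ) (p := a))
    have h2 := (hasDerivAt_diskKernel ((norm_snd_le a).trans_lt ha') hz'.2.le).comp_hasFDerivAt a
      (hasFDerivAt_snd (𝕜 := ℂ) (p := a))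
    refine ((h1.mul h2).const_mul (F z)).congr_fderiv ?_
    simp only [hD, hd, Function.comp_apply, smul_smul]

/-- The kernel function at `a` as an element of the Bergman space; `0` for `a` outside the
bidisc. -/
noncomputable def kernelElem (a : ℂ × ℂ) : bergmanSpace bidisc := by
  classical
  exact if h : a ∈ bidisc then
    ⟨(memBergman_bidiscKernel h).2.toLp _, _, (memBergman_bidiscKernel h).1,
      (memBergman_bidiscKernel h).2.coeFn_toLp⟩ else 0

theorem kernelElem_ae {a : ℂ × ℂ} (ha : a ∈ bidisc) :
    (kernelElem a : Lp ℂ 2 (volume.restrict bidisc)) =ᵐ[volume.restrict bidisc]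
      fun z => bidiscKernel z a := by
  rw [kernelElem, dif_pos ha]
  exact (memBergman_bidiscKernel ha).2.coeFn_toLp

theorem inner_kernelElem_eq_integral {a : ℂ × ℂ} (ha : a ∈ bidisc)
    (F : Lp ℂ 2 (volume.restrict bidisc)) :
    inner ℂ (kernelElem a : Lp ℂ 2 (volume.restrict bidisc)) F =
      ∫ z in bidisc, F z * bidiscKernel a z := by
  rw [L2.inner_def]
  refine integral_congr_ae ?_
  filter_upwards [kernelElem_ae ha] with z hz
  rw [hz, RCLike.inner_apply, conj_bidiscKernel]

theorem memLp_of_ae_eq {F : Lp ℂ 2 (volume.restrict bidisc)} {f : ℂ × ℂ → ℂ}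
    (h : F =ᵐ[volume.restrict bidisc] f) : MemLp f 2 (volume.restrict bidisc) :=
  (memLp_congr_ae h).1 (Lp.memLp F)

/-- The kernel functions represent point evaluation. -/
theorem inner_kernelElem_left {a : ℂ × ℂ} (ha : a ∈ bidisc)
    {F : Lp ℂ 2 (volume.restrict bidisc)} {f : ℂ × ℂ → ℂ} (hf : DifferentiableOn ℂ f bidisc)
    (hF : F =ᵐ[volume.restrict bidisc] f) :
    inner ℂ (kernelElem a : Lp ℂ 2 (volume.restrict bidisc)) F = f a := by
  rw [inner_kernelElem_eq_integral ha,
    ← bidiscKernel_reproducing hf ((memLp_of_ae_eq hF).integrable one_le_two) ha]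
  refine integral_congr_ae ?_
  filter_upwards [hF] with z hz
  rw [hz]

theorem isClosed_bergmanSpace :
    IsClosed (bergmanSpace bidisc : Set (Lp ℂ 2 (volume.restrict bidisc))) := by
  refine isClosed_of_closure_subset fun F hF => ?_
  obtain ⟨u, hu, hlim⟩ := mem_closure_iff_seq_limit.1 hF
  choose f hfd hfu using hu
  have hFi : IntegrableOn F bidisc := (Lp.memLp F).integrable one_le_two
  refine ⟨_, differentiableOn_integral_mul_bidiscKernel hFi, ?_⟩
  -- along a subsequence the representatives converge almost everywhere to `F`, and at every point
  -- to the Bergman projection of `F`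
  obtain ⟨ns, hns, hae⟩ := (tendstoInMeasure_of_tendsto_Lp hlim).exists_seq_tendsto_ae
  have hall : ∀ᵐ z ∂(volume.restrict bidisc), ∀ n, u n z = f n z := ae_all_iff.2 hfu
  filter_upwards [hae, hall, ae_restrict_mem isOpen_bidisc.measurableSet] with z h1 h2 hz
  refine tendsto_nhds_unique h1 ?_
  rw [← inner_kernelElem_eq_integral hz]
  have h3 : Tendsto (fun n => inner ℂ (kernelElem z : Lp ℂ 2 (volume.restrict bidisc)) (u n)) atTop
      (𝓝 (inner ℂ (kernelElem z : Lp ℂ 2 (volume.restrict bidisc)) F)) :=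
    tendsto_const_nhds.inner hlim
  refine (h3.comp hns.tendsto_atTop).congr fun n => ?_
  rw [Function.comp_apply, inner_kernelElem_left hz (hfd _) (hfu _), h2]

instance completeSpace_bergmanSpace_bidisc : CompleteSpace (bergmanSpace bidisc) :=
  isClosed_bergmanSpace.completeSpace_coe

theorem norm_kernelElem_sq {a : ℂ × ℂ} (ha : a ∈ bidisc) :
    ‖kernelElem a‖ ^ 2 = (Real.pi * bidiscWeight a)⁻¹ ^ 2 := by
  have h := inner_kernelElem_left ha
    (differentiableOn_bidiscKernel (norm_lt_one_of_mem_bidisc ha).le) (kernelElem_ae ha)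
  rw [inner_self_eq_norm_sq_to_K, bidiscKernel_self] at h
  refine Complex.ofReal_injective ?_
  rw [← h]
  push_cast
  rfl

theorem norm_kernelElem {a : ℂ × ℂ} (ha : a ∈ bidisc) :
    ‖kernelElem a‖ = (Real.pi * bidiscWeight a)⁻¹ := by
  have := bidiscWeight_pos ha
  have := Real.pi_pos
  exact (sq_eq_sq₀ (norm_nonneg _) (by positivity)).1 (norm_kernelElem_sq ha)

/-- A function orthogonal to all kernel functions vanishes, so the kernel functions span a dense
subspace. -/
theorem span_kernelElem_dense :
    (Submodule.span ℂ (kernelElem '' bidisc)).topologicalClosure = ⊤ := by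
  rw [Submodule.topologicalClosure_eq_top_iff, Submodule.eq_bot_iff]
  intro G hG
  obtain ⟨g, hg, hGg⟩ := G.2
  have h0 : ∀ a ∈ bidisc, g a = 0 := fun a ha => by
    rw [← inner_kernelElem_left ha hg hGg]
    exact (Submodule.mem_orthogonal _ _).1 hG _ (Submodule.subset_span ⟨a, ha, rfl⟩)
  refine Subtype.ext (Lp.ext ?_)
  filter_upwards [hGg, Lp.coeFn_zero ℂ 2 (volume.restrict bidisc),
    ae_restrict_mem isOpen_bidisc.measurableSet] with z h1 h2 hz
  rw [h1, h0 z hz]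
  exact h2.symm

/-! ### Necessity: normalised kernels tend weakly to zero -/

theorem frontier_bidisc : frontier bidisc = Metric.sphere (0 : ℂ × ℂ) 1 := by
  rw [bidisc_eq_ball, frontier_ball _ one_ne_zero]

theorem bidiscWeight_le_left {z : ℂ × ℂ} (hz : z ∈ bidisc) : bidiscWeight z ≤ 1 - ‖z.1‖ ^ 2 := by
  have hz' := mem_bidisc.1 hz
  have h1 := norm_nonneg z.1
  have h2 := norm_nonneg z.2
  exact mul_le_of_le_one_right (by nlinarith) (by nlinarith)

theorem bidiscWeight_le_right {z : ℂ × ℂ} (hz : z ∈ bidisc) : bidiscWeight z ≤ 1 - ‖z.2‖ ^ 2 := by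
  have hz' := mem_bidisc.1 hz
  have h1 := norm_nonneg z.1
  have h2 := norm_nonneg z.2
  exact mul_le_of_le_one_left (by nlinarith) (by nlinarith)

theorem bidiscWeight_le {z : ℂ × ℂ} (hz : z ∈ bidisc) :
    bidiscWeight z ≤ 2 * Metric.infDist z (frontier bidisc) := by
  have h1 : 1 - ‖z‖ ≤ Metric.infDist z (frontier bidisc) := by
    rw [frontier_bidisc]
    have hne : (Metric.sphere (0 : ℂ × ℂ) 1).Nonempty := ⟨(1, 0), by simp⟩
    refine (Metric.le_infDist hne).2 fun p hp => ?_
    rw [mem_sphere_zero_iff_norm] at hp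
    have := norm_sub_norm_le p z
    rw [hp, ← dist_eq_norm, dist_comm] at this
    exact this
  refine le_trans ?_ (mul_le_mul_of_nonneg_left h1 zero_le_two)
  have hz' := mem_bidisc.1 hz
  have n1 := norm_nonneg z.1
  have n2 := norm_nonneg z.2
  have hw1 := bidiscWeight_le_left hz
  have hw2 := bidiscWeight_le_right hz
  rw [Prod.norm_def]
  rcases max_cases ‖z.1‖ ‖z.2‖ with h | h <;> rw [h.1] <;> nlinarith

theorem towardBoundary_le_principal (Ω : Set (ℂ × ℂ)) : towardBoundary Ω ≤ 𝓟 Ω := inf_le_right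

theorem tendsto_bidiscWeight : Tendsto bidiscWeight (towardBoundary bidisc) (𝓝 0) := by
  have hmem : ∀ᶠ z in towardBoundary bidisc, z ∈ bidisc :=
    towardBoundary_le_principal _ (mem_principal_self _)
  have h : Tendsto (fun z => 2 * Metric.infDist z (frontier bidisc)) (towardBoundary bidisc)
      (𝓝 (2 * 0)) := (tendsto_comap.mono_left inf_le_left).const_mul 2
  rw [mul_zero] at h
  refine squeeze_zero' ?_ ?_ h
  · filter_upwards [hmem] with z hz using (bidiscWeight_pos hz).le
  · filter_upwards [hmem] with z hz using bidiscWeight_le hz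

/-- The normalised kernels tend weakly to zero at the boundary: on a kernel function `K_w`, which is
bounded, this holds because `‖K_z‖ → ∞`, and these functions span a dense subspace. -/
theorem eventually_norm_inner_kernelElem_le (G : bergmanSpace bidisc) {ε : ℝ} (hε : 0 < ε) :
    ∀ᶠ z in towardBoundary bidisc, ‖inner ℂ (kernelElem z) G‖ ≤ ε * ‖kernelElem z‖ := by
  have hmem : ∀ᶠ z in towardBoundary bidisc, z ∈ bidisc :=
    towardBoundary_le_principal _ (mem_principal_self _)
  have hspan : ∀ G ∈ Submodule.span ℂ (kernelElem '' bidisc), ∀ ε > 0,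
      ∀ᶠ z in towardBoundary bidisc, ‖inner ℂ (kernelElem z) G‖ ≤ ε * ‖kernelElem z‖ := by
    intro G hG
    induction hG using Submodule.span_induction with
    | mem x hx =>
      obtain ⟨w, hw, rfl⟩ := hx
      intro ε hε
      set C := (Real.pi * (1 - ‖w‖) ^ 2)⁻¹ ^ 2 * Real.pi with hC
      have hlim : ∀ᶠ z in towardBoundary bidisc, C * bidiscWeight z < ε := by
        have := tendsto_bidiscWeight.const_mul C
        rw [mul_zero] at this
        exact this.eventually_lt_const hε
      filter_upwards [hmem, hlim] with z hz h
      have hin : inner ℂ (kernelElem z) (kernelElem w) = bidiscKernel z w :=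
        inner_kernelElem_left hz
          (differentiableOn_bidiscKernel (norm_lt_one_of_mem_bidisc hw).le) (kernelElem_ae hw)
      have hp := mul_pos Real.pi_pos (bidiscWeight_pos hz)
      rw [hin, norm_kernelElem hz, ← div_eq_mul_inv, le_div_iff₀ hp]
      calc ‖bidiscKernel z w‖ * (Real.pi * bidiscWeight z)
          ≤ (Real.pi * (1 - ‖w‖) ^ 2)⁻¹ ^ 2 * (Real.pi * bidiscWeight z) :=
            mul_le_mul_of_nonneg_right (norm_bidiscKernel_le' hw hz) hp.le
        _ = C * bidiscWeight z := by rw [hC]; ring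
        _ ≤ ε := h.le
    | zero =>
      intro ε hε
      refine .of_forall fun z => ?_
      rw [inner_zero_right, norm_zero]
      positivity
    | add x y _ _ hx hy =>
      intro ε hε
      filter_upwards [hx (ε / 2) (half_pos hε), hy (ε / 2) (half_pos hε)] with z h1 h2
      rw [inner_add_right]
      refine (norm_add_le _ _).trans ?_
      linarith
    | smul c x _ hx =>
      intro ε hε
      filter_upwards [hx (ε / (‖c‖ + 1)) (by positivity)] with z h1
      rw [inner_smul_right, norm_mul]
      calc ‖c‖ * ‖inner ℂ (kernelElem z) x‖
          ≤ (‖c‖ + 1) * (ε / (‖c‖ + 1) * ‖kernelElem z‖) := by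
            gcongr
            linarith
        _ = ε * ‖kernelElem z‖ := by field_simp
  have hG : G ∈ closure (Submodule.span ℂ (kernelElem '' bidisc) : Set (bergmanSpace bidisc)) := by
    rw [← Submodule.topologicalClosure_coe, span_kernelElem_dense]
    trivial
  obtain ⟨G', hG', hd⟩ := Metric.mem_closure_iff.1 hG (ε / 2) (half_pos hε)
  filter_upwards [hspan G' hG' (ε / 2) (half_pos hε)] with z h
  have e : G = G' + (G - G') := by abel
  rw [e, inner_add_right]
  refine (norm_add_le _ _).trans ?_
  have h1 := norm_inner_le_norm (𝕜 := ℂ) (kernelElem z) (G - G')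
  rw [dist_eq_norm] at hd
  have h2 : ‖kernelElem z‖ * ‖G - G'‖ ≤ ‖kernelElem z‖ * (ε / 2) := by gcongr
  linarith

theorem tendsto_weight_ratio_of_isCompact {φ : ℂ × ℂ → ℂ × ℂ}
    (hol : DifferentiableOn ℂ φ bidisc) (hm : MapsTo φ bidisc bidisc)
    (h : CompositionOperatorIsCompact bidisc φ) :
    Tendsto (fun z => bidiscWeight z / bidiscWeight (φ z)) (towardBoundary bidisc) (𝓝 0) := by
  obtain ⟨T, hT, hc⟩ := h
  have hmem : ∀ᶠ z in towardBoundary bidisc, z ∈ bidisc :=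
    towardBoundary_le_principal _ (mem_principal_self _)
  obtain ⟨K, hK, hTK⟩ := hc.image_closedBall_subset_compact 1
  -- weak convergence of the bounded family of normalised kernels is uniform on compact sets
  have hunif : ∀ ε > 0, ∀ᶠ z in towardBoundary bidisc, ∀ G ∈ K,
      ‖inner ℂ (kernelElem z) G‖ ≤ ε * ‖kernelElem z‖ := by
    intro ε hε
    obtain ⟨t, htf, ht⟩ := Metric.totallyBounded_iff.1 hK.totallyBounded (ε / 2) (half_pos hε)
    have hall : ∀ᶠ z in towardBoundary bidisc, ∀ G ∈ t,
        ‖inner ℂ (kernelElem z) G‖ ≤ ε / 2 * ‖kernelElem z‖ :=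
      (eventually_all_finite htf).2 fun G _ =>
        eventually_norm_inner_kernelElem_le G (half_pos hε)
    filter_upwards [hall] with z hz G hG
    obtain ⟨G', hG', hd⟩ := mem_iUnion₂.1 (ht hG)
    have e : G = G' + (G - G') := by abel
    rw [e, inner_add_right]
    refine (norm_add_le _ _).trans ?_
    have h1 := norm_inner_le_norm (𝕜 := ℂ) (kernelElem z) (G - G')
    rw [Metric.mem_ball, dist_eq_norm] at hd
    have h2 : ‖kernelElem z‖ * ‖G - G'‖ ≤ ‖kernelElem z‖ * (ε / 2) := by gcongr
    have h3 := hz G' hG'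
    linarith
  rw [Metric.tendsto_nhds]
  intro ε hε
  filter_upwards [hmem, hunif (ε / 2) (half_pos hε)] with z hz hz'
  have hw := hm hz
  have hp := bidiscWeight_pos hz
  have hpw := bidiscWeight_pos hw
  have hpi := Real.pi_pos
  set c : ℂ := ((‖kernelElem (φ z)‖⁻¹ : ℝ) : ℂ) with hcdef
  have hnpos : 0 < ‖kernelElem (φ z)‖ := by rw [norm_kernelElem hw]; positivity
  have hin : T (c • kernelElem (φ z)) ∈ K := by
    refine hTK ⟨_, ?_, rfl⟩
    rw [mem_closedBall_zero_iff, norm_smul, hcdef, Complex.norm_real, norm_inv, norm_norm,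
      inv_mul_cancel₀ hnpos.ne']
  have hd : DifferentiableOn ℂ (c • fun v => bidiscKernel v (φ z)) bidisc :=
    (differentiableOn_bidiscKernel (norm_lt_one_of_mem_bidisc hw).le).const_smul c
  have hrep : ((c • kernelElem (φ z) : bergmanSpace bidisc) : Lp ℂ 2 (volume.restrict bidisc))
      =ᵐ[volume.restrict bidisc] c • fun v => bidiscKernel v (φ z) :=
    (Lp.coeFn_smul c _).trans ((kernelElem_ae hw).const_smul c)
  have hval : inner ℂ (kernelElem z) (T (c • kernelElem (φ z))) = c * bidiscKernel (φ z) (φ z) :=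
    inner_kernelElem_left hz (hd.comp hol hm) (hT _ _ hd hrep)
  have hkey := hz' _ hin
  rw [hval, bidiscKernel_self, ← norm_kernelElem_sq hw, hcdef, ← Complex.ofReal_mul,
    Complex.norm_real, sq, inv_mul_cancel_left₀ hnpos.ne', norm_norm, norm_kernelElem hw,
    norm_kernelElem hz] at hkey
  rw [Real.dist_eq, sub_zero, abs_of_pos (div_pos hp hpw)]
  have : bidiscWeight z / bidiscWeight (φ z) ≤ ε / 2 := by
    rw [div_le_iff₀ hpw]
    rw [← div_eq_mul_inv, inv_le_comm₀ (by positivity) (by positivity), inv_div,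
      div_le_iff₀ (by positivity)] at hkey
    nlinarith
  linarith

/-! ### Boundary values of the symbol -/

theorem closure_bidisc : closure bidisc = Metric.closedBall (0 : ℂ × ℂ) 1 := by
  rw [bidisc_eq_ball, closure_ball _ one_ne_zero]

theorem smul_mem_bidisc {p : ℂ × ℂ} (hp : ‖p‖ = 1) {r : ℝ} (hr : r ∈ Ioo (0 : ℝ) 1) :
    r • p ∈ bidisc := by
  rw [bidisc_eq_ball, mem_ball_zero_iff, norm_smul, hp, mul_one, Real.norm_of_nonneg hr.1.le]
  exact hr.2

theorem eventually_mem_Ioo_nhdsLT_one : ∀ᶠ r in 𝓝[<] (1 : ℝ), r ∈ Ioo (0 : ℝ) 1 :=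
  Ioo_mem_nhdsLT zero_lt_one

theorem tendsto_smul_towardBoundary {p : ℂ × ℂ} (hp : ‖p‖ = 1) :
    Tendsto (fun r : ℝ => r • p) (𝓝[<] 1) (towardBoundary bidisc) := by
  refine tendsto_inf.2 ⟨tendsto_comap_iff.2 ?_, tendsto_principal.2 ?_⟩
  · have hc : Continuous fun r : ℝ => Metric.infDist (r • p) (frontier bidisc) :=
      (Metric.continuous_infDist_pt _).comp (by fun_prop)
    have h := (hc.tendsto 1).mono_left (nhdsWithin_le_nhds (s := Iio 1))
    rwa [one_smul, Metric.infDist_zero_of_mem] at h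
    rw [frontier_bidisc, mem_sphere_zero_iff_norm, hp]
  · filter_upwards [eventually_mem_Ioo_nhdsLT_one] with r hr using smul_mem_bidisc hp hr

/-- The ratio of weights tends to zero along radii, so it has no positive lower bound there. -/
theorem not_eventually_mul_weight_le {φ : ℂ × ℂ → ℂ × ℂ} (hm : MapsTo φ bidisc bidisc)
    (h : Tendsto (fun z => bidiscWeight z / bidiscWeight (φ z)) (towardBoundary bidisc) (𝓝 0))
    {p : ℂ × ℂ} (hp : ‖p‖ = 1) {c : ℝ} (hc : 0 < c) :
    ¬ ∀ r ∈ Ioo (0 : ℝ) 1, c * bidiscWeight (φ (r • p)) ≤ bidiscWeight (r • p) := by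
  intro hle
  have h1 := ((h.comp (tendsto_smul_towardBoundary hp)).eventually_lt_const hc).and
    eventually_mem_Ioo_nhdsLT_one
  obtain ⟨r, hlt, hr⟩ := h1.exists
  have hpos := bidiscWeight_pos (hm (smul_mem_bidisc hp hr))
  rw [Function.comp_apply, div_lt_iff₀ hpos] at hlt
  exact absurd (hle r hr) (not_le.2 hlt)

/-- Where a Lipschitz function has a unimodular boundary value, its distance to the unit circle
is at most linear along the radius. -/
theorem one_sub_norm_sq_le_of_lipschitz {g : ℂ × ℂ → ℂ} {L : NNReal}
    (hg : LipschitzOnWith L g (closure bidisc)) {p : ℂ × ℂ} (hp : ‖p‖ = 1) (hgp : ‖g p‖ = 1)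
    {r : ℝ} (hr : r ∈ Ioo (0 : ℝ) 1) (hlt : ‖g (r • p)‖ < 1) :
    1 - ‖g (r • p)‖ ^ 2 ≤ 2 * (L + 1) * (1 - r) := by
  have hpc : p ∈ closure bidisc := by rw [closure_bidisc, mem_closedBall_zero_iff, hp]
  have h1 := hg.dist_le_mul p hpc (r • p) (subset_closure (smul_mem_bidisc hp hr))
  have h2 : dist p (r • p) = 1 - r := by
    have e : p - r • p = (1 - r) • p := by rw [sub_smul, one_smul]
    rw [dist_eq_norm, e, norm_smul, hp, mul_one, Real.norm_of_nonneg (by linarith [hr.2])]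
  rw [h2, dist_eq_norm] at h1
  have h3 := norm_sub_norm_le (g p) (g (r • p))
  have h4 := norm_nonneg (g (r • p))
  rw [hgp] at h3
  have h5 := hr.2
  nlinarith

theorem one_sub_le_one_sub_norm_smul_sq {w : ℂ} (hw : ‖w‖ ≤ 1) {r : ℝ} (hr : r ∈ Ioo (0 : ℝ) 1) :
    1 - r ≤ 1 - ‖r • w‖ ^ 2 ∧ 1 - ‖w‖ ^ 2 ≤ 1 - ‖r • w‖ ^ 2 := by
  have h1 : ‖r • w‖ = r * ‖w‖ := by rw [norm_smul, Real.norm_of_nonneg hr.1.le]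
  have h2 : r * ‖w‖ ≤ r := mul_le_of_le_one_right hr.1.le hw
  have h3 : r * ‖w‖ ≤ ‖w‖ := mul_le_of_le_one_left (norm_nonneg _) hr.2.le
  have h4 : 0 ≤ r * ‖w‖ := mul_nonneg hr.1.le (norm_nonneg _)
  rw [h1]
  constructor
  · nlinarith [hr.1, hr.2]
  · nlinarith

section Symbol

variable {φ : ℂ × ℂ → ℂ × ℂ} {L₁ L₂ : NNReal}

theorem continuousOn_of_lipschitz_coords
    (h₁ : LipschitzOnWith L₁ (fun z => (φ z).1) (closure bidisc))
    (h₂ : LipschitzOnWith L₂ (fun z => (φ z).2) (closure bidisc)) :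
    ContinuousOn φ (closure bidisc) :=
  h₁.continuousOn.prodMk h₂.continuousOn

theorem norm_le_one_of_mem_closure (hm : MapsTo φ bidisc bidisc)
    (hc : ContinuousOn φ (closure bidisc)) {p : ℂ × ℂ} (hp : p ∈ closure bidisc) : ‖φ p‖ ≤ 1 := by
  have := hm.closure_of_continuousOn hc hp
  rwa [closure_bidisc, mem_closedBall_zero_iff] at this

/-- Off the distinguished boundary the symbol has its values in the open bidisc: otherwise the
Lipschitz condition bounds the ratio of weights from below along a radius. -/
theorem norm_lt_one_of_mem_closure (hm : MapsTo φ bidisc bidisc)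
    (h₁ : LipschitzOnWith L₁ (fun z => (φ z).1) (closure bidisc))
    (h₂ : LipschitzOnWith L₂ (fun z => (φ z).2) (closure bidisc))
    (h : Tendsto (fun z => bidiscWeight z / bidiscWeight (φ z)) (towardBoundary bidisc) (𝓝 0))
    {p : ℂ × ℂ} (hp : p ∈ closure bidisc) (hlt : ‖p.1‖ < 1 ∨ ‖p.2‖ < 1) : ‖φ p‖ < 1 := by
  have hle := norm_le_one_of_mem_closure hm (continuousOn_of_lipschitz_coords h₁ h₂) hp
  have hp1 : ‖p‖ ≤ 1 := by rwa [closure_bidisc, mem_closedBall_zero_iff] at hp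
  rcases hp1.lt_or_eq with hp1 | hp1
  · exact norm_lt_one_of_mem_bidisc (hm (by rwa [bidisc_eq_ball, mem_ball_zero_iff]))
  refine lt_of_le_of_ne hle fun hφ => ?_
  have hn1 : ‖p.1‖ ≤ 1 := (norm_fst_le p).trans hp1.le
  have hn2 : ‖p.2‖ ≤ 1 := (norm_snd_le p).trans hp1.le
  -- a lower bound for the weight of `r • p`, linear in `1 - r`
  obtain ⟨κ, hκ, hκle⟩ : ∃ κ > 0, ∀ r ∈ Ioo (0 : ℝ) 1, κ * (1 - r) ≤ bidiscWeight (r • p) := by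
    rcases hlt with hlt | hlt
    · refine ⟨1 - ‖p.1‖ ^ 2, by nlinarith [norm_nonneg p.1], fun r hr => ?_⟩
      exact mul_le_mul (one_sub_le_one_sub_norm_smul_sq hn1 hr).2
        (one_sub_le_one_sub_norm_smul_sq hn2 hr).1 (by linarith [hr.2])
        (le_trans (sub_nonneg.2 hr.2.le) (one_sub_le_one_sub_norm_smul_sq hn1 hr).1)
    · refine ⟨1 - ‖p.2‖ ^ 2, by nlinarith [norm_nonneg p.2], fun r hr => ?_⟩
      rw [mul_comm]
      exact mul_le_mul (one_sub_le_one_sub_norm_smul_sq hn1 hr).1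
        (one_sub_le_one_sub_norm_smul_sq hn2 hr).2 (by nlinarith [norm_nonneg p.2])
        (le_trans (sub_nonneg.2 hr.2.le) (one_sub_le_one_sub_norm_smul_sq hn1 hr).1)
  obtain ⟨M, hM, hMle⟩ : ∃ M > 0, ∀ r ∈ Ioo (0 : ℝ) 1,
      bidiscWeight (φ (r • p)) ≤ M * (1 - r) := by
    rw [Prod.norm_def] at hφ
    rcases max_choice ‖(φ p).1‖ ‖(φ p).2‖ with e | e <;> rw [e] at hφ
    · refine ⟨2 * (L₁ + 1), by positivity, fun r hr => ?_⟩
      have hb := hm (smul_mem_bidisc hp1 hr)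
      exact (bidiscWeight_le_left hb).trans
        (one_sub_norm_sq_le_of_lipschitz h₁ hp1 hφ hr (mem_bidisc.1 hb).1)
    · refine ⟨2 * (L₂ + 1), by positivity, fun r hr => ?_⟩
      have hb := hm (smul_mem_bidisc hp1 hr)
      exact (bidiscWeight_le_right hb).trans
        (one_sub_norm_sq_le_of_lipschitz h₂ hp1 hφ hr (mem_bidisc.1 hb).2)
  refine not_eventually_mul_weight_le hm h hp1 (div_pos hκ hM) fun r hr => ?_
  refine le_trans ?_ (hκle r hr)
  rw [div_mul_eq_mul_div, div_le_iff₀ hM, mul_assoc]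
  exact mul_le_mul_of_nonneg_left ((hMle r hr).trans_eq (mul_comm _ _)) hκ.le

/-- The two coordinates of the symbol are nowhere unimodular at the same time. -/
theorem min_norm_lt_one_of_mem_closure (hm : MapsTo φ bidisc bidisc)
    (h₁ : LipschitzOnWith L₁ (fun z => (φ z).1) (closure bidisc))
    (h₂ : LipschitzOnWith L₂ (fun z => (φ z).2) (closure bidisc))
    (h : Tendsto (fun z => bidiscWeight z / bidiscWeight (φ z)) (towardBoundary bidisc) (𝓝 0))
    {p : ℂ × ℂ} (hp : p ∈ closure bidisc) : min ‖(φ p).1‖ ‖(φ p).2‖ < 1 := by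
  have hle := norm_le_one_of_mem_closure hm (continuousOn_of_lipschitz_coords h₁ h₂) hp
  have hp1 : ‖p‖ ≤ 1 := by rwa [closure_bidisc, mem_closedBall_zero_iff] at hp
  rcases hp1.lt_or_eq with hp1 | hp1
  · exact min_lt_of_left_lt
      (mem_bidisc.1 (hm (by rwa [bidisc_eq_ball, mem_ball_zero_iff]))).1
  by_contra hcon
  rw [not_lt, le_min_iff] at hcon
  have hφ1 : ‖(φ p).1‖ = 1 := le_antisymm ((norm_fst_le _).trans hle) hcon.1
  have hφ2 : ‖(φ p).2‖ = 1 := le_antisymm ((norm_snd_le _).trans hle) hcon.2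
  have hn1 : ‖p.1‖ ≤ 1 := (norm_fst_le p).trans hp1.le
  have hn2 : ‖p.2‖ ≤ 1 := (norm_snd_le p).trans hp1.le
  refine not_eventually_mul_weight_le hm h hp1
    (c := ((2 * (L₁ + 1)) * (2 * (L₂ + 1)) : ℝ)⁻¹) (by positivity) fun r hr => ?_
  have hb := hm (smul_mem_bidisc hp1 hr)
  have hb' := mem_bidisc.1 hb
  have e1 := one_sub_norm_sq_le_of_lipschitz h₁ hp1 hφ1 hr hb'.1
  have e2 := one_sub_norm_sq_le_of_lipschitz h₂ hp1 hφ2 hr hb'.2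
  have e3 : (1 - r) * (1 - r) ≤ bidiscWeight (r • p) :=
    mul_le_mul (one_sub_le_one_sub_norm_smul_sq hn1 hr).1
      (one_sub_le_one_sub_norm_smul_sq hn2 hr).1 (by linarith [hr.2])
      (le_trans (sub_nonneg.2 hr.2.le) (one_sub_le_one_sub_norm_smul_sq hn1 hr).1)
  have e4 : bidiscWeight (φ (r • p)) ≤ (2 * (L₁ + 1) * (1 - r)) * (2 * (L₂ + 1) * (1 - r)) := by
    refine mul_le_mul e1 e2 (by nlinarith [norm_nonneg (φ (r • p)).2]) ?_
    have := hr.2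
    have : 0 < 1 - r := by linarith
    positivity
  rw [inv_mul_le_iff₀ (by positivity)]
  refine e4.trans ?_
  calc (2 * (L₁ + 1) * (1 - r)) * (2 * (L₂ + 1) * (1 - r))
      = (2 * (L₁ + 1)) * (2 * (L₂ + 1)) * ((1 - r) * (1 - r)) := by ring
    _ ≤ _ := by gcongr

theorem exists_norm_le_lt_one_of_isCompact (hc : ContinuousOn φ (closure bidisc))
    {K : Set (ℂ × ℂ)} (hK : IsCompact K) (hsub : K ⊆ closure bidisc)
    (hlt : ∀ p ∈ K, ‖φ p‖ < 1) : ∃ s < 1, ∀ p ∈ K, ‖φ p‖ ≤ s := by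
  rcases K.eq_empty_or_nonempty with rfl | hne
  · exact ⟨0, zero_lt_one, by simp⟩
  obtain ⟨q, hq, hmax⟩ := hK.exists_isMaxOn hne (hc.mono hsub).norm
  exact ⟨_, hlt q hq, fun p hp => hmax hp⟩

theorem exists_coord_le_lt_one (hm : MapsTo φ bidisc bidisc)
    (h₁ : LipschitzOnWith L₁ (fun z => (φ z).1) (closure bidisc))
    (h₂ : LipschitzOnWith L₂ (fun z => (φ z).2) (closure bidisc))
    (h : Tendsto (fun z => bidiscWeight z / bidiscWeight (φ z)) (towardBoundary bidisc) (𝓝 0)) :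
    ∃ r < 1, ∀ z ∈ bidisc, ‖(φ z).1‖ ≤ r ∨ ‖(φ z).2‖ ≤ r := by
  have hK : IsCompact (closure bidisc) := closure_bidisc ▸ isCompact_closedBall _ _
  have hne : (closure bidisc).Nonempty := ⟨0, by simp [closure_bidisc]⟩
  have hcont : ContinuousOn (fun z => min ‖(φ z).1‖ ‖(φ z).2‖) (closure bidisc) :=
    ContinuousOn.inf h₁.continuousOn.norm h₂.continuousOn.norm
  obtain ⟨q, hq, hmax⟩ := hK.exists_isMaxOn hne hcont
  refine ⟨_, min_norm_lt_one_of_mem_closure hm h₁ h₂ h hq, fun z hz => ?_⟩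
  exact min_le_iff.1 (hmax (subset_closure hz))

end Symbol

/-! ### Integral estimates for the composition operator -/

/-- Littlewood subordination with parameters: the first variable of `f` is composed with the slices
`z ↦ ψ (z, v)` for `v` in a subset `S` of the disc, and the second is integrated out. -/
theorem lintegral_comp_slice_le {f ψ : ℂ × ℂ → ℂ} (hf : DifferentiableOn ℂ f bidisc)
    (hψ : DifferentiableOn ℂ ψ bidisc) (hm : MapsTo ψ bidisc (Metric.ball 0 1)) {s₀ : ℝ}
    (hs : s₀ < 1) (h0 : ∀ w : ℂ, ‖w‖ < 1 → ‖ψ (0, w)‖ ≤ s₀) {S : Set ℂ}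
    (hS : MeasurableSet S) (hSb : S ⊆ Metric.ball 0 1) :
    ∫⁻ z in Metric.ball 0 1 ×ˢ S, ∫⁻ w in Metric.ball 0 1, ENNReal.ofReal (‖f (ψ z, w)‖ ^ 2) ≤
      ENNReal.ofReal (16 / (1 - s₀) ^ 2) * volume S *
        ∫⁻ z in bidisc, ENNReal.ofReal (‖f z‖ ^ 2) := by
  have hball : MeasurableSet (Metric.ball (0 : ℂ) 1) := Metric.isOpen_ball.measurableSet
  have hsub : Metric.ball (0 : ℂ) 1 ×ˢ S ⊆ bidisc := prod_mono subset_rfl hSb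
  have hfc : ContinuousOn (fun z => ENNReal.ofReal (‖f z‖ ^ 2)) bidisc :=
    ENNReal.continuous_ofReal.comp_continuousOn (hf.continuousOn.norm.pow 2)
  have hmeas : AEMeasurable (fun p : (ℂ × ℂ) × ℂ => ENNReal.ofReal (‖f (ψ p.1, p.2)‖ ^ 2))
      ((volume.restrict (Metric.ball (0 : ℂ) 1 ×ˢ S)).prod
        (volume.restrict (Metric.ball 0 1))) := by
    rw [Measure.prod_restrict]
    refine ContinuousOn.aemeasurable ?_ ((hball.prod hS).prod hball)
    refine hfc.comp (f := fun p : (ℂ × ℂ) × ℂ => (ψ p.1, p.2)) ?_ fun p hp =>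
      ⟨hm (hsub hp.1), hp.2⟩
    exact (hψ.continuousOn.comp continuousOn_fst fun p hp => hsub hp.1).prodMk continuousOn_snd
  have hout : AEMeasurable (fun z => ∫⁻ w in Metric.ball 0 1, ENNReal.ofReal (‖f (ψ z, w)‖ ^ 2))
      (volume.restrict (Metric.ball (0 : ℂ) 1 ×ˢ S)) := hmeas.lintegral_prod_right'
  have hprod : (volume : Measure (ℂ × ℂ)).restrict (Metric.ball (0 : ℂ) 1 ×ˢ S) =
      (volume.restrict (Metric.ball 0 1)).prod (volume.restrict S) := by
    rw [Measure.volume_eq_prod, Measure.prod_restrict]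
  rw [hprod] at hout ⊢
  rw [lintegral_prod_symm _ hout]
  have hI : ∫⁻ w in Metric.ball 0 1, ∫⁻ z in Metric.ball 0 1, ENNReal.ofReal (‖f (z, w)‖ ^ 2) =
      ∫⁻ z in bidisc, ENNReal.ofReal (‖f z‖ ^ 2) := by
    have h := hfc.aemeasurable isOpen_bidisc.measurableSet (μ := volume)
    rw [restrict_bidisc] at h ⊢
    exact (lintegral_prod_symm _ h).symm
  calc ∫⁻ v in S, ∫⁻ z in Metric.ball 0 1, ∫⁻ w in Metric.ball 0 1,
        ENNReal.ofReal (‖f (ψ (z, v), w)‖ ^ 2)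
      ≤ ∫⁻ _ in S, ENNReal.ofReal (16 / (1 - s₀) ^ 2) *
          ∫⁻ z in bidisc, ENNReal.ofReal (‖f z‖ ^ 2) := by
        refine setLIntegral_mono' hS fun v hv => ?_
        have hv' : ‖v‖ < 1 := mem_ball_zero_iff.1 (hSb hv)
        have hψv := hψ.slice_left hv'
        have hmv : MapsTo (fun z => ψ (z, v)) (Metric.ball 0 1) (Metric.ball 0 1) := fun z hz =>
          hm ⟨hz, hSb hv⟩
        have hsw : AEMeasurable (fun p : ℂ × ℂ => ENNReal.ofReal (‖f (ψ (p.1, v), p.2)‖ ^ 2))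
            ((volume.restrict (Metric.ball 0 1)).prod (volume.restrict (Metric.ball 0 1))) := by
          rw [Measure.prod_restrict]
          refine ContinuousOn.aemeasurable ?_ (hball.prod hball)
          refine hfc.comp (f := fun p : ℂ × ℂ => (ψ (p.1, v), p.2)) ?_ fun p hp =>
            ⟨hmv hp.1, hp.2⟩
          exact (hψv.continuousOn.comp continuousOn_fst fun p hp => hp.1).prodMk continuousOn_snd
        rw [lintegral_lintegral_swap hsw, ← hI, ← lintegral_const_mul' _ _ ENNReal.ofReal_ne_top]
        refine setLIntegral_mono' hball fun w hw => ?_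
        exact lintegral_norm_sq_comp_le (hf.slice_left (mem_ball_zero_iff.1 hw)) hψv hmv
          (h0 v hv') hs
    _ = _ := by
        rw [setLIntegral_const]
        ring

theorem lintegral_bidisc_swap (f : ℂ × ℂ → ℂ) :
    ∫⁻ z in bidisc, ENNReal.ofReal (‖f z.swap‖ ^ 2) =
      ∫⁻ z in bidisc, ENNReal.ofReal (‖f z‖ ^ 2) := by
  rw [restrict_bidisc]
  exact lintegral_prod_swap (fun z => ENNReal.ofReal (‖f z‖ ^ 2))

/-- The main estimate. When one of the coordinates of `φ z` stays in a fixed smaller disc, `f` at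
`φ z` is controlled by its mean square over that coordinate, and Littlewood subordination handles
the other one. The factor `volume S` makes the contribution of a thin set `S` small. -/
theorem exists_lintegral_comp_le {φ : ℂ × ℂ → ℂ × ℂ} (hol : DifferentiableOn ℂ φ bidisc)
    (hm : MapsTo φ bidisc bidisc) {s₀ r : ℝ} (hs : s₀ < 1)
    (h0 : ∀ w : ℂ, ‖w‖ < 1 → ‖φ (0, w)‖ ≤ s₀) (hr : r < 1)
    (hmin : ∀ z ∈ bidisc, ‖(φ z).1‖ ≤ r ∨ ‖(φ z).2‖ ≤ r) :
    ∃ C : ℝ, ∀ S : Set ℂ, MeasurableSet S → S ⊆ Metric.ball 0 1 →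
      ∀ f : ℂ × ℂ → ℂ, DifferentiableOn ℂ f bidisc →
        ∫⁻ z in Metric.ball 0 1 ×ˢ S, ENNReal.ofReal (‖f (φ z)‖ ^ 2) ≤
          ENNReal.ofReal C * volume S * ∫⁻ z in bidisc, ENNReal.ofReal (‖f z‖ ^ 2) := by
  set A := (Real.pi * (1 - r) ^ 2)⁻¹ with hA
  have hA0 : 0 ≤ A := by have := Real.pi_pos; positivity
  set B := 16 / (1 - s₀) ^ 2 with hB
  have hB0 : 0 ≤ B := by positivity
  -- `A` comes from evaluation in the coordinate of modulus at most `r`, `B` from subordination in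
  -- the other one; the sum of both alternatives avoids a measurable choice between them
  refine ⟨2 * (A * B), fun S hS hSb f hf => ?_⟩
  have hball : MeasurableSet (Metric.ball (0 : ℂ) 1) := Metric.isOpen_ball.measurableSet
  have hsub : Metric.ball (0 : ℂ) 1 ×ˢ S ⊆ bidisc := prod_mono subset_rfl hSb
  have hfs : DifferentiableOn ℂ (fun z => f z.swap) bidisc :=
    hf.comp (f := Prod.swap) (differentiable_snd.prodMk differentiable_fst).differentiableOn
      fun z hz => ⟨hz.2, hz.1⟩
  have hφ1 : DifferentiableOn ℂ (fun z => (φ z).1) bidisc := hol.fst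
  have hφ2 : DifferentiableOn ℂ (fun z => (φ z).2) bidisc := hol.snd
  set I := ∫⁻ z in bidisc, ENNReal.ofReal (‖f z‖ ^ 2) with hI
  have e1 := lintegral_comp_slice_le hf hφ1 (fun z hz => (hm hz).1) hs
    (fun w hw => (norm_fst_le _).trans (h0 w hw)) hS hSb
  have e2 := lintegral_comp_slice_le hfs hφ2 (fun z hz => (hm hz).2) hs
    (fun w hw => (norm_snd_le _).trans (h0 w hw)) hS hSb
  rw [lintegral_bidisc_swap f] at e2
  set U : ℂ × ℂ → ENNReal := fun z =>
    ∫⁻ w in Metric.ball 0 1, ENNReal.ofReal (‖f ((φ z).1, w)‖ ^ 2) with hU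
  set V : ℂ × ℂ → ENNReal := fun z =>
    ∫⁻ w in Metric.ball 0 1, ENNReal.ofReal (‖f (w, (φ z).2)‖ ^ 2) with hV
  have hUm : AEMeasurable U (volume.restrict (Metric.ball (0 : ℂ) 1 ×ˢ S)) := by
    refine AEMeasurable.lintegral_prod_right' (f := fun p : (ℂ × ℂ) × ℂ =>
      ENNReal.ofReal (‖f ((φ p.1).1, p.2)‖ ^ 2)) ?_
    rw [Measure.prod_restrict]
    refine ContinuousOn.aemeasurable ?_ ((hball.prod hS).prod hball)
    refine ENNReal.continuous_ofReal.comp_continuousOn (ContinuousOn.pow (ContinuousOn.norm ?_) 2)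
    refine hf.continuousOn.comp (f := fun p : (ℂ × ℂ) × ℂ => ((φ p.1).1, p.2)) ?_ fun p hp =>
      ⟨(hm (hsub hp.1)).1, hp.2⟩
    exact (hφ1.continuousOn.comp continuousOn_fst fun p hp => hsub hp.1).prodMk continuousOn_snd
  calc ∫⁻ z in Metric.ball 0 1 ×ˢ S, ENNReal.ofReal (‖f (φ z)‖ ^ 2)
      ≤ ∫⁻ z in Metric.ball 0 1 ×ˢ S, ENNReal.ofReal A * (U z + V z) := by
        refine setLIntegral_mono' (hball.prod hS) fun z hz => ?_
        have hz' := mem_bidisc.1 (hm (hsub hz))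
        rcases hmin z (hsub hz) with h | h
        · exact (norm_sq_le_lintegral_ball (hf.slice_left hz'.2) hr h).trans
            (mul_le_mul_right le_add_self _)
        · exact (norm_sq_le_lintegral_ball (hf.slice_right hz'.1) hr h).trans
            (mul_le_mul_right le_self_add _)
    _ = ENNReal.ofReal A * ((∫⁻ z in Metric.ball 0 1 ×ˢ S, U z) +
          ∫⁻ z in Metric.ball 0 1 ×ˢ S, V z) := by
        rw [lintegral_const_mul' _ _ ENNReal.ofReal_ne_top, lintegral_add_left' hUm]
    _ ≤ ENNReal.ofReal A * (ENNReal.ofReal B * volume S * I + ENNReal.ofReal B * volume S * I) := by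
        gcongr
        exact e2
    _ = ENNReal.ofReal (2 * (A * B)) * volume S * I := by
        rw [ENNReal.ofReal_mul zero_le_two, ENNReal.ofReal_mul hA0, ENNReal.ofReal_ofNat]
        ring

/-! ### A criterion for compactness -/

/-- An operator that is bounded by finitely many functionals up to an arbitrarily small multiple of
the norm is compact. -/
theorem isCompactOperator_of_norm_le_add {E F : Type*} [NormedAddCommGroup E] [NormedSpace ℂ E]
    [NormedAddCommGroup F] [NormedSpace ℂ F] [CompleteSpace F] (T : E →ₗ[ℂ] F)
    (h : ∀ ε > 0, ∃ (n : ℕ) (Λ : E →L[ℂ] (Fin n → ℂ)) (D : ℝ),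
      ∀ x, ‖T x‖ ≤ ε * ‖x‖ + D * ‖Λ x‖) :
    IsCompactOperator T := by
  have htb : TotallyBounded (T '' Metric.closedBall 0 1) := by
    refine Metric.totallyBounded_iff.2 fun ε hε => ?_
    obtain ⟨n, Λ, D, hD⟩ := h (ε / 4) (by positivity)
    have hbdd : Bornology.IsBounded (Λ '' Metric.closedBall 0 1) :=
      Λ.lipschitz.isBounded_image Metric.isBounded_closedBall
    have hb : TotallyBounded (Λ '' Metric.closedBall 0 1) :=
      hbdd.isCompact_closure.totallyBounded.subset subset_closure
    have hδ : 0 < ε / (4 * (|D| + 1)) := by positivity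
    obtain ⟨u, hu, huf, hcov⟩ := Metric.finite_approx_of_totallyBounded hb _ hδ
    obtain ⟨v, hv, hvf, hcov⟩ := exists_subset_image_finite_and
      (p := fun u => Λ '' Metric.closedBall 0 1 ⊆ ⋃ y ∈ u, Metric.ball y (ε / (4 * (|D| + 1)))).1
      ⟨u, hu, huf, hcov⟩
    refine ⟨T '' v, hvf.image _, ?_⟩
    rintro _ ⟨x, hx, rfl⟩
    obtain ⟨_, ⟨y, hy, rfl⟩, hxy⟩ := mem_iUnion₂.1 (hcov ⟨x, hx, rfl⟩)
    refine mem_iUnion₂.2 ⟨T y, ⟨y, hy, rfl⟩, ?_⟩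
    have hx1 := mem_closedBall_zero_iff.1 hx
    have hy1 := mem_closedBall_zero_iff.1 (hv hy)
    have h1 := hD (x - y)
    have h2 : ‖Λ (x - y)‖ < ε / (4 * (|D| + 1)) := by
      rwa [Metric.mem_ball, dist_eq_norm, ← map_sub] at hxy
    have h3 : ‖x - y‖ ≤ 2 := (norm_sub_le _ _).trans (by linarith)
    have h4 : D * ‖Λ (x - y)‖ ≤ ε / 4 := by
      calc D * ‖Λ (x - y)‖
          ≤ (|D| + 1) * (ε / (4 * (|D| + 1))) := by
            gcongr
            linarith [le_abs_self D]
        _ = ε / 4 := by field_simp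
    rw [Metric.mem_ball, dist_eq_norm, ← map_sub]
    have h5 : ε / 4 * ‖x - y‖ ≤ ε / 4 * 2 := by gcongr
    linarith
  exact (isCompactOperator_iff_isCompact_closure_image_closedBall T zero_lt_one).2
    (htb.closure.isCompact_of_isClosed isClosed_closure)

/-! ### Sufficiency: the composition operator and its compactness -/

/-- The holomorphic representative of an element of the Bergman space, given by pairing with the
kernel functions; it depends linearly on the element at every point. -/
noncomputable def holoRep (F : bergmanSpace bidisc) (a : ℂ × ℂ) : ℂ := inner ℂ (kernelElem a) F

theorem holoRep_eq {F : bergmanSpace bidisc} {f : ℂ × ℂ → ℂ} (hf : DifferentiableOn ℂ f bidisc)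
    (hF : (F : Lp ℂ 2 (volume.restrict bidisc)) =ᵐ[volume.restrict bidisc] f) {a : ℂ × ℂ}
    (ha : a ∈ bidisc) : holoRep F a = f a :=
  inner_kernelElem_left ha hf hF

theorem differentiableOn_holoRep (F : bergmanSpace bidisc) :
    DifferentiableOn ℂ (holoRep F) bidisc := by
  obtain ⟨f, hf, hF⟩ := F.2
  exact hf.congr fun a ha => holoRep_eq hf hF ha

theorem holoRep_ae (F : bergmanSpace bidisc) :
    (F : Lp ℂ 2 (volume.restrict bidisc)) =ᵐ[volume.restrict bidisc] holoRep F := by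
  obtain ⟨f, hf, hF⟩ := F.2
  filter_upwards [hF, ae_restrict_mem isOpen_bidisc.measurableSet] with z hz hzb
  rw [hz, holoRep_eq hf hF hzb]

theorem ofReal_norm_sq_eq_lintegral {F : Lp ℂ 2 (volume.restrict bidisc)} {f : ℂ × ℂ → ℂ}
    (hF : F =ᵐ[volume.restrict bidisc] f) :
    ENNReal.ofReal (‖F‖ ^ 2) = ∫⁻ z in bidisc, ENNReal.ofReal (‖f z‖ ^ 2) := by
  have h1 : ‖F‖ ^ 2 = ∫ z in bidisc, ‖F z‖ ^ 2 := by
    have h := @L2.inner_def (ℂ × ℂ) ℂ ℂ _ _ (volume.restrict bidisc) _ _ F F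
    simp only [inner_self_eq_norm_sq_to_K] at h
    have h2 : ((‖F‖ ^ 2 : ℝ) : ℂ) = ((∫ z in bidisc, ‖F z‖ ^ 2 : ℝ) : ℂ) := by
      rw [← integral_complex_ofReal]
      push_cast
      exact h
    exact Complex.ofReal_injective h2
  rw [h1, ofReal_integral_eq_lintegral_ofReal ((Lp.memLp F).integrable_norm_pow two_ne_zero)
    (.of_forall fun _ => by positivity)]
  refine lintegral_congr_ae ?_
  filter_upwards [hF] with z hz
  rw [hz]

/-- The composition operator, for a symbol that maps `A²` into `L²`. -/
noncomputable def compositionOperator (φ : ℂ × ℂ → ℂ × ℂ) (hol : DifferentiableOn ℂ φ bidisc)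
    (hm : MapsTo φ bidisc bidisc)
    (hL : ∀ F : bergmanSpace bidisc, MemLp (holoRep F ∘ φ) 2 (volume.restrict bidisc)) :
    bergmanSpace bidisc →ₗ[ℂ] bergmanSpace bidisc where
  toFun F := ⟨(hL F).toLp _, _, (differentiableOn_holoRep F).comp hol hm, (hL F).coeFn_toLp⟩
  map_add' F G := by
    refine Subtype.ext ?_
    exact (MemLp.toLp_congr (hL (F + G)) ((hL F).add (hL G))
      (.of_forall fun z => inner_add_right _ _ _)).trans (MemLp.toLp_add (hL F) (hL G))
  map_smul' c F := by
    refine Subtype.ext ?_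
    exact (MemLp.toLp_congr (hL (c • F)) ((hL F).const_smul c)
      (.of_forall fun z => inner_smul_right (𝕜 := ℂ) (kernelElem (φ z)) F c)).trans
      (MemLp.toLp_const_smul c (hL F))

theorem compositionOperator_ae {φ : ℂ × ℂ → ℂ × ℂ} (hol : DifferentiableOn ℂ φ bidisc)
    (hm : MapsTo φ bidisc bidisc)
    (hL : ∀ F : bergmanSpace bidisc, MemLp (holoRep F ∘ φ) 2 (volume.restrict bidisc))
    (F : bergmanSpace bidisc) :
    (compositionOperator φ hol hm hL F : Lp ℂ 2 (volume.restrict bidisc))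
      =ᵐ[volume.restrict bidisc] holoRep F ∘ φ :=
  (hL F).coeFn_toLp

theorem isCompositionOperator_compositionOperator {φ : ℂ × ℂ → ℂ × ℂ}
    (hol : DifferentiableOn ℂ φ bidisc) (hm : MapsTo φ bidisc bidisc)
    (hL : ∀ F : bergmanSpace bidisc, MemLp (holoRep F ∘ φ) 2 (volume.restrict bidisc)) :
    IsCompositionOperator bidisc φ (compositionOperator φ hol hm hL) := by
  intro F f hf hF
  filter_upwards [compositionOperator_ae hol hm hL F,
    ae_restrict_mem isOpen_bidisc.measurableSet] with z hz hzb
  rw [hz]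
  exact holoRep_eq hf hF (hm hzb)

theorem continuousOn_kernelElem : ContinuousOn kernelElem bidisc := by
  have hk : ∀ z ∈ bidisc, ∀ w ∈ bidisc, inner ℂ (kernelElem z) (kernelElem w) = bidiscKernel z w :=
    fun z hz w hw => inner_kernelElem_left hz
      (differentiableOn_bidiscKernel (norm_lt_one_of_mem_bidisc hw).le) (kernelElem_ae hw)
  intro w hw
  rw [ContinuousWithinAt, tendsto_iff_norm_sub_tendsto_zero]
  have h1 : Tendsto (fun z => ‖kernelElem z‖ ^ 2) (𝓝[bidisc] w) (𝓝 (‖kernelElem w‖ ^ 2)) := by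
    rw [norm_kernelElem_sq hw]
    have hc : ContinuousWithinAt (fun z => (Real.pi * bidiscWeight z)⁻¹ ^ 2) bidisc w := by
      refine ContinuousWithinAt.pow (ContinuousWithinAt.inv₀ ?_ ?_) 2
      · unfold bidiscWeight
        fun_prop
      · exact (mul_pos Real.pi_pos (bidiscWeight_pos hw)).ne'
    refine hc.tendsto.congr' ?_
    filter_upwards [self_mem_nhdsWithin] with z hz
    rw [norm_kernelElem_sq hz]
  have h2 : Tendsto (fun z => RCLike.re (inner ℂ (kernelElem z) (kernelElem w))) (𝓝[bidisc] w)
      (𝓝 (‖kernelElem w‖ ^ 2)) := by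
    rw [← inner_self_eq_norm_sq (𝕜 := ℂ), hk w hw w hw]
    have hc := (differentiableOn_bidiscKernel (norm_lt_one_of_mem_bidisc hw).le).continuousOn w hw
    refine ((RCLike.continuous_re.tendsto _).comp hc.tendsto).congr' ?_
    filter_upwards [self_mem_nhdsWithin] with z hz
    rw [Function.comp_apply, hk z hz w hw]
  have h3 : Tendsto (fun z => ‖kernelElem z - kernelElem w‖ ^ 2) (𝓝[bidisc] w) (𝓝 0) := by
    have := (h1.sub (h2.const_mul 2)).add_const (‖kernelElem w‖ ^ 2)
    have e : ‖kernelElem w‖ ^ 2 - 2 * ‖kernelElem w‖ ^ 2 + ‖kernelElem w‖ ^ 2 = 0 := by ring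
    rw [e] at this
    refine this.congr fun z => ?_
    rw [norm_sub_sq (𝕜 := ℂ)]
  have h4 := (Real.continuous_sqrt.tendsto 0).comp h3
  rw [Real.sqrt_zero] at h4
  exact h4.congr fun z => Real.sqrt_sq (norm_nonneg _)

/-- On a compact concentric polydisc a function in the Bergman space is controlled by
finitely many functionals, up to a small multiple of its norm: the kernel functions of the points of
the polydisc form a compact set, and are thus close to finitely many elements. -/
theorem exists_clm_norm_holoRep_le {s : ℝ} (hs : s < 1) {ε : ℝ} (hε : 0 < ε) :
    ∃ (n : ℕ) (Λ : bergmanSpace bidisc →L[ℂ] (Fin n → ℂ)), ∀ F : bergmanSpace bidisc,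
      ∀ z : ℂ × ℂ, ‖z‖ ≤ s → ‖holoRep F z‖ ≤ ε * ‖F‖ + ‖Λ F‖ := by
  have hsub : Metric.closedBall (0 : ℂ × ℂ) s ⊆ bidisc := by
    rw [bidisc_eq_ball]
    exact Metric.closedBall_subset_ball hs
  have hK : IsCompact (kernelElem '' Metric.closedBall (0 : ℂ × ℂ) s) :=
    (isCompact_closedBall _ _).image_of_continuousOn (continuousOn_kernelElem.mono hsub)
  obtain ⟨u, huf, hu⟩ := Metric.totallyBounded_iff.1 hK.totallyBounded ε hε
  obtain ⟨n, q, -, rfl⟩ := huf.fin_param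
  refine ⟨n, ContinuousLinearMap.pi fun i => innerSL ℂ (q i), fun F z hz => ?_⟩
  obtain ⟨_, ⟨i, rfl⟩, hd⟩ := mem_iUnion₂.1 (hu ⟨z, mem_closedBall_zero_iff.2 hz, rfl⟩)
  have e : kernelElem z = (kernelElem z - q i) + q i := by abel
  rw [holoRep, e, inner_add_left]
  refine (norm_add_le _ _).trans (add_le_add ?_ ?_)
  · rw [Metric.mem_ball, dist_eq_norm] at hd
    exact (norm_inner_le_norm _ _).trans (mul_le_mul_of_nonneg_right hd.le (norm_nonneg _))
  · exact norm_le_pi_norm (ContinuousLinearMap.pi (fun i => innerSL ℂ (q i)) F) i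

theorem exists_volume_annulus_lt {ε : ENNReal} (hε : 0 < ε) :
    ∃ R : ℝ, R < 1 ∧ volume (Metric.ball (0 : ℂ) 1 \ Metric.closedBall 0 R) < ε := by
  set S : ℕ → Set ℂ := fun n => Metric.ball (0 : ℂ) 1 \ Metric.closedBall 0 (1 - 1 / ((n : ℝ) + 1))
    with hS
  have hanti : Antitone S := fun m n hmn => by
    refine sdiff_subset_sdiff_right (Metric.closedBall_subset_closedBall ?_)
    have := Nat.one_div_le_one_div (α := ℝ) hmn
    linarith
  have hempty : ⋂ n, S n = ∅ := by
    refine eq_empty_iff_forall_notMem.2 fun z hz => ?_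
    have hz1 : ‖z‖ < 1 := mem_ball_zero_iff.1 (mem_iInter.1 hz 0).1
    obtain ⟨n, hn⟩ := exists_nat_one_div_lt (sub_pos.2 hz1)
    exact (mem_iInter.1 hz n).2 (mem_closedBall_zero_iff.2 (by linarith))
  have hlim := tendsto_measure_iInter_atTop (μ := volume) (s := S)
    (fun n => (Metric.isOpen_ball.measurableSet.diff
      Metric.isClosed_closedBall.measurableSet).nullMeasurableSet) hanti
    ⟨0, ((measure_mono sdiff_subset).trans_lt measure_ball_lt_top).ne⟩
  rw [hempty, measure_empty] at hlim
  obtain ⟨n, hn⟩ := (hlim.eventually_lt_const hε).exists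
  exact ⟨_, by simp only [sub_lt_self_iff]; positivity, hn⟩

/-- The disc is split into a closed disc of radius `R` and a thin annulus. Where the second
variable lies in the former, `φ` has its values in a compact polydisc; the contribution of the
latter is small in operator norm. -/
theorem compositionOperatorIsCompact_of_bounds {φ : ℂ × ℂ → ℂ × ℂ}
    (hol : DifferentiableOn ℂ φ bidisc) (hm : MapsTo φ bidisc bidisc) {s₀ r : ℝ} (hs : s₀ < 1)
    (h0 : ∀ w : ℂ, ‖w‖ < 1 → ‖φ (0, w)‖ ≤ s₀) (hr : r < 1)
    (hmin : ∀ z ∈ bidisc, ‖(φ z).1‖ ≤ r ∨ ‖(φ z).2‖ ≤ r)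
    (hslice : ∀ R < 1, ∃ s < 1, ∀ z ∈ bidisc, ‖z.2‖ ≤ R → ‖φ z‖ ≤ s) :
    CompositionOperatorIsCompact bidisc φ := by
  obtain ⟨C, hC⟩ := exists_lintegral_comp_le hol hm hs h0 hr hmin
  have hball : MeasurableSet (Metric.ball (0 : ℂ) 1) := Metric.isOpen_ball.measurableSet
  have hL : ∀ F : bergmanSpace bidisc, MemLp (holoRep F ∘ φ) 2 (volume.restrict bidisc) := by
    intro F
    have hd := (differentiableOn_holoRep F).comp hol hm
    have hmeas := hd.continuousOn.aestronglyMeasurable (μ := volume) isOpen_bidisc.measurableSet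
    refine (memLp_two_iff_integrable_sq_norm hmeas).2 ⟨hmeas.norm.pow 2, ?_⟩
    have h1 := hC _ hball subset_rfl _ (differentiableOn_holoRep F)
    rw [← ofReal_norm_sq_eq_lintegral (holoRep_ae F)] at h1
    refine lt_of_le_of_lt (le_of_eq_of_le (lintegral_congr fun z => ?_) h1) ?_
    · exact Real.enorm_of_nonneg (by positivity)
    · exact ENNReal.mul_lt_top (ENNReal.mul_lt_top ENNReal.ofReal_lt_top measure_ball_lt_top)
        ENNReal.ofReal_lt_top
  refine ⟨compositionOperator φ hol hm hL, isCompositionOperator_compositionOperator hol hm hL, ?_⟩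
  refine isCompactOperator_of_norm_le_add _ fun ε hε => ?_
  have hvtop : volume bidisc ≠ ⊤ := by rw [bidisc_eq_ball]; exact measure_ball_lt_top.ne
  set V := (volume bidisc).toReal with hV
  have hV0 : 0 ≤ V := ENNReal.toReal_nonneg
  set η := ε / (2 + V) with hη
  have hη0 : 0 < η := by positivity
  obtain ⟨R, hR, hvol⟩ : ∃ R < 1,
      ENNReal.ofReal C * volume (Metric.ball (0 : ℂ) 1 \ Metric.closedBall 0 R) ≤
        ENNReal.ofReal (η ^ 2) := by
    obtain ⟨R, hR, hlt⟩ := exists_volume_annulus_lt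
      (ε := ENNReal.ofReal (η ^ 2 / (|C| + 1))) (by rw [ENNReal.ofReal_pos]; positivity)
    refine ⟨R, hR, ?_⟩
    calc _ ≤ ENNReal.ofReal (|C| + 1) * ENNReal.ofReal (η ^ 2 / (|C| + 1)) := by
          gcongr
          linarith [le_abs_self C]
      _ = ENNReal.ofReal (η ^ 2) := by
          rw [← ENNReal.ofReal_mul (by positivity)]
          congr 1
          field_simp
  obtain ⟨s, hs1, hsφ⟩ := hslice R hR
  obtain ⟨n, Λ, hΛ⟩ := exists_clm_norm_holoRep_le hs1 hη0
  refine ⟨n, Λ, 1 + V, fun F => ?_⟩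
  set N := ‖Λ F‖ with hN
  have hN0 : 0 ≤ N := norm_nonneg _
  set S := Metric.ball (0 : ℂ) 1 \ Metric.closedBall 0 R with hS
  have hSm : MeasurableSet S := hball.diff Metric.isClosed_closedBall.measurableSet
  set S' := Metric.ball (0 : ℂ) 1 ∩ Metric.closedBall 0 R with hS'
  have hsplit : bidisc = Metric.ball (0 : ℂ) 1 ×ˢ S' ∪ Metric.ball (0 : ℂ) 1 ×ˢ S := by
    rw [← prod_union, hS, hS', inter_union_sdiff]
    rfl
  have hsubS' : Metric.ball (0 : ℂ) 1 ×ˢ S' ⊆ bidisc := prod_mono subset_rfl inter_subset_left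
  have hS'm : MeasurableSet S' := hball.inter Metric.isClosed_closedBall.measurableSet
  have hgood : ∫⁻ z in Metric.ball (0 : ℂ) 1 ×ˢ S', ENNReal.ofReal (‖holoRep F (φ z)‖ ^ 2) ≤
      ENNReal.ofReal ((η * ‖F‖ + N) ^ 2 * V) := by
    calc ∫⁻ z in Metric.ball (0 : ℂ) 1 ×ˢ S', ENNReal.ofReal (‖holoRep F (φ z)‖ ^ 2)
        ≤ ∫⁻ _ in Metric.ball (0 : ℂ) 1 ×ˢ S', ENNReal.ofReal ((η * ‖F‖ + N) ^ 2) := by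
          refine setLIntegral_mono' (hball.prod hS'm) fun z hz => ?_
          have := hΛ F (φ z) (hsφ z (hsubS' hz) (mem_closedBall_zero_iff.1 hz.2.2))
          gcongr
      _ ≤ ENNReal.ofReal ((η * ‖F‖ + N) ^ 2) * volume bidisc := by
          rw [setLIntegral_const]
          gcongr
      _ = _ := by
          rw [ENNReal.ofReal_mul (by positivity), hV, ENNReal.ofReal_toReal hvtop]
  have hbad : ∫⁻ z in Metric.ball (0 : ℂ) 1 ×ˢ S, ENNReal.ofReal (‖holoRep F (φ z)‖ ^ 2) ≤
      ENNReal.ofReal (η ^ 2 * ‖F‖ ^ 2) := by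
    refine (hC S hSm sdiff_subset _ (differentiableOn_holoRep F)).trans ?_
    rw [← ofReal_norm_sq_eq_lintegral (holoRep_ae F), ENNReal.ofReal_mul (by positivity)]
    exact mul_le_mul_left hvol _
  have hsq : ‖compositionOperator φ hol hm hL F‖ ^ 2 ≤
      (η * ‖F‖ + N) ^ 2 * V + η ^ 2 * ‖F‖ ^ 2 := by
    rw [← ENNReal.ofReal_le_ofReal_iff (by positivity),
      ENNReal.ofReal_add (by positivity) (by positivity)]
    refine le_trans ?_ (add_le_add hgood hbad)
    refine (ofReal_norm_sq_eq_lintegral (compositionOperator_ae hol hm hL F)).trans_le ?_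
    conv_lhs => rw [hsplit]
    exact lintegral_union_le _ _ _
  have hfin : ‖compositionOperator φ hol hm hL F‖ ≤ η * ‖F‖ + (1 + V) * (η * ‖F‖ + N) := by
    refine (sq_le_sq₀ (norm_nonneg _) (by positivity)).1 (hsq.trans ?_)
    have hx : 0 ≤ η * ‖F‖ := by positivity
    have hy : 0 ≤ η * ‖F‖ + N := by positivity
    nlinarith [mul_nonneg hV0 (sq_nonneg (η * ‖F‖ + N)), mul_nonneg hx hy,
      mul_nonneg (mul_nonneg hV0 hx) hy, mul_nonneg (mul_nonneg hV0 hV0) (mul_nonneg hy hy)]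
  refine hfin.trans (le_of_eq ?_)
  have hε' : ε = η * (2 + V) := by rw [hη]; field_simp
  rw [hε']
  ring

theorem mainTheorem3 (φ : ℂ × ℂ → ℂ × ℂ)
    (hol : DifferentiableOn ℂ φ bidisc)
    (hmaps : MapsTo φ bidisc bidisc)
    (hlip₁ : ∃ L₁ : NNReal, LipschitzOnWith L₁ (fun z => (φ z).1) (closure bidisc))
    (hlip₂ : ∃ L₂ : NNReal, LipschitzOnWith L₂ (fun z => (φ z).2) (closure bidisc)) :
    CompositionOperatorIsCompact bidisc φ ↔
      Tendsto (fun z => bergmanKernel bidisc (φ z) (φ z) / bergmanKernel bidisc z z)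
        (towardBoundary bidisc) (𝓝 0) := by
  rw [tendsto_bergmanKernel_ratio_iff hmaps (towardBoundary_le_principal _)]
  refine ⟨tendsto_weight_ratio_of_isCompact hol hmaps, fun h => ?_⟩
  obtain ⟨L₁, h₁⟩ := hlip₁
  obtain ⟨L₂, h₂⟩ := hlip₂
  have hc := continuousOn_of_lipschitz_coords h₁ h₂
  obtain ⟨r, hr, hmin⟩ := exists_coord_le_lt_one hmaps h₁ h₂ h
  have hprod : ∀ a b : ℝ, a ≤ 1 → b ≤ 1 →
      Metric.closedBall (0 : ℂ) a ×ˢ Metric.closedBall (0 : ℂ) b ⊆ closure bidisc :=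
    fun a b ha hb p hp => by
      rw [closure_bidisc, mem_closedBall_zero_iff, Prod.norm_def]
      exact max_le ((mem_closedBall_zero_iff.1 hp.1).trans ha)
        ((mem_closedBall_zero_iff.1 hp.2).trans hb)
  have hK : ∀ a b : ℝ, IsCompact (Metric.closedBall (0 : ℂ) a ×ˢ Metric.closedBall (0 : ℂ) b) :=
    fun a b => (isCompact_closedBall _ _).prod (isCompact_closedBall _ _)
  obtain ⟨s₀, hs₀, h0⟩ := exists_norm_le_lt_one_of_isCompact hc (hK 0 1)
    (hprod 0 1 zero_le_one le_rfl)
    fun p hp => norm_lt_one_of_mem_closure hmaps h₁ h₂ h (hprod 0 1 zero_le_one le_rfl hp)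
      (.inl ((mem_closedBall_zero_iff.1 hp.1).trans_lt zero_lt_one))
  refine compositionOperatorIsCompact_of_bounds hol hmaps hs₀ (fun w hw => h0 _
    ⟨Metric.mem_closedBall_self le_rfl, mem_closedBall_zero_iff.2 hw.le⟩) hr hmin fun R hR => ?_
  obtain ⟨s, hs, hsφ⟩ := exists_norm_le_lt_one_of_isCompact hc (hK 1 R) (hprod 1 R le_rfl hR.le)
    fun p hp => norm_lt_one_of_mem_closure hmaps h₁ h₂ h (hprod 1 R le_rfl hR.le hp)
      (.inr ((mem_closedBall_zero_iff.1 hp.2).trans_lt hR))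
  exact ⟨s, hs, fun z hz hzR => hsφ z ⟨mem_closedBall_zero_iff.2 (mem_bidisc.1 hz).1.le,
    mem_closedBall_zero_iff.2 hzR⟩⟩
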